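/- Let $\mathbb D=\{|z|<1\}$. Consider the three geometries: $E^2=\mathbb C$ with metric $|dw|^2$; $H^2=\{|w|<1\}$ with metric $4|dw|^2/(1-|w|^2)^2$; and $S^2=\mathbb C\cup\{\infty\}$, the round unit sphere, with metric $4|dw|^2/(1+|w|^2)^2$. Let $X$ be one of them and $\delta$ its metric. A distorted disk in $X$ is a continuous map $F:\overline{\mathbb D}\to X$ whose restriction to $\mathbb D$ is an orientation-preserving $C^1$ immersion and which, if $X=S^2$, is moreover injective near each boundary point (this holds whenever $F$ is a $C^1$ immersion of the closed disk). Let $A[F^*\delta]$ be the area of $\mathbb D$ for the pulled back constant curvature metric $F^*\delta$, and let $A[\Omega]$ be the area of $\Omega\subset X$ for $\delta$. Let $\gamma:\mathbb R/2\pi\mathbb Z\to X$ be a continuous, piecewise $C^1$ closed curve. We say that $F$ is bounded by $\gamma$ if $F|_{\partial\mathbb D}$ is $\gamma$ up to an orientation-preserving reparametrization. (1) Let $X=E^2$ or $H^2$. The winding number $\frac1{2\pi i}\int_0^{2\pi}\frac{\gamma'}{\gamma-w}\,d\theta$ is an integer $\nu(\Omega)$ for all $w$ in a component $\Omega$ of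 $\mathbb C\setminus\operatorname{Im}\gamma$. If a distorted disk $F$ is bounded by $\gamma$, then each $w\in\Omega$ has exactly $\nu(\Omega)$ preimages in $\mathbb D$, the area $A[F^*\delta]$ is finite, and $$A[F^*\delta]=\sum_i\nu(\Omega_i)\,A[\Omega_i],$$ where the sum is over the bounded components $\Omega_i$ of $\mathbb C\setminus\operatorname{Im}\gamma$. (2) Let $X=S^2$. There are integers $\nu(\Omega)$, one for each component $\Omega$ of $S^2\setminus\operatorname{Im}\gamma$ and depending only on $\gamma$, such that for every distorted disk $F$ bounded by $\gamma$ each point of $\Omega$ has exactly $\nu(\Omega)$ preimages in $\mathbb D$, the area $A[F^*\delta]$ is finite, and $A[F^*\delta]=\sum_i\nu(\Omega_i)A[\Omega_i]$, where the sum is over all components $\Omega_i$ of $S^2\setminus\operatorname{Im}\gamma$. If $\infty\notin\operatorname{Im}\gamma$ and $\Omega_\infty$ is the component containing $\infty$, then $\nu(\Omega)-\nu(\Omega_\infty)$ is the winding number of $\gamma$ around any $w\in\Omega\setminus\{\infty\}$; so $\nu(\Omega)$ is the winding number itself when $F$ does not cover $\infty$. In all three cases, any two distorted disks bounded by the same curve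 $\gamma$ have equal area. -/

import Mathlib

open Set Metric MeasureTheory
open scoped Topology Real

noncomputable section

namespace DistortedDisk

/-! ### Closed curves and winding numbers -/

/-- A closed curve: a continuous `2π`-periodic map that is piecewise `C¹`, i.e. `C¹` (up to the
end points) on each of the finitely many closed intervals of a subdivision of `[0, 2π]`. -/
structure IsClosedCurve {E : Type*} [NormedAddCommGroup E] [NormedSpace ℝ E] (γ : ℝ → E) :
    Prop where
  continuous : Continuous γ
  periodic : ∀ θ, γ (θ + 2 * π) = γ θ
  piecewise : ∃ (n : ℕ) (t : ℕ → ℝ), Monotone t ∧ t 0 = 0 ∧ t n = 2 * π ∧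
    ∀ i < n, ContDiffOn ℝ 1 γ (Icc (t i) (t (i + 1)))

/-- The winding number `(2πi)⁻¹ ∫ γ' / (γ - w) dθ` of a closed curve in `ℂ` around `w`. -/
def windingNumber (γ : ℝ → ℂ) (w : ℂ) : ℂ :=
  (2 * π * Complex.I)⁻¹ * ∫ θ in (0 : ℝ)..(2 * π), deriv γ θ / (γ θ - w)

/-- The connected components of `X \ K`. -/
def complementComponents {E : Type*} [TopologicalSpace E] (X K : Set E) : Set (Set E) :=
  {Ω | ∃ P ∈ X \ K, Ω = connectedComponentIn (X \ K) P}

/-- The closed curve `γ` is the boundary of the map `F` of the closed unit disk: up to an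
orientation preserving reparametrization, `F` restricted to the unit circle is `γ`. -/
def Bounds {E : Type*} (γ : ℝ → E) (F : ℂ → E) : Prop :=
  ∃ φ : ℝ → ℝ, Continuous φ ∧ StrictMono φ ∧ (∀ θ, φ (θ + 2 * π) = φ θ + 2 * π) ∧
    ∀ θ : ℝ, F (Complex.exp (θ * Complex.I)) = γ (φ θ)

/-- The points of the open unit disk above `P`; their number is the number of layers at `P`. -/
def layers {E : Type*} (F : ℂ → E) (P : E) : Set ℂ :=
  {z | z ∈ ball (0 : ℂ) 1 ∧ F z = P}

/-! ### Pulled back metrics and areas -/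

/-- The pull-back by `F` of the metric `ρ(p) ⟨·, ·⟩`, as a field of bilinear forms on the disk. -/
def pullbackMetric {E : Type*} [NormedAddCommGroup E] [InnerProductSpace ℝ E]
    (ρ : E → ℝ) (F : ℂ → E) (z u v : ℂ) : ℝ :=
  ρ (F z) * inner ℝ (fderiv ℝ F z u) (fderiv ℝ F z v)

/-- The area `∫ √(det g) dx dy` of the open unit disk for the metric `g`. -/
def diskArea (g : ℂ → ℂ → ℂ → ℝ) : ENNReal :=
  ∫⁻ z in ball (0 : ℂ) 1,
    ENNReal.ofReal (√(g z 1 1 * g z Complex.I Complex.I - g z 1 Complex.I * g z Complex.I 1))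

/-! ### The Euclidean and the hyperbolic plane -/

inductive PlaneGeometry
  | euclidean
  | hyperbolic

namespace PlaneGeometry

/-- `E²` is `ℂ`, and `H²` is the open unit disk (Poincaré model). -/
def domain : PlaneGeometry → Set ℂ
  | euclidean => univ
  | hyperbolic => ball 0 1

/-- The metric is `factor w * |dw|²`: `|dw|²` on `E²` and `4 |dw|² / (1 - |w|²)²` on `H²`. -/
def factor : PlaneGeometry → ℂ → ℝ
  | euclidean => fun _ => 1
  | hyperbolic => fun w => 4 / (1 - ‖w‖ ^ 2) ^ 2

/-- The area of a set for the metric `factor w * |dw|²`. -/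
def setArea (G : PlaneGeometry) (Ω : Set ℂ) : ENNReal :=
  ∫⁻ w in Ω, ENNReal.ofReal (G.factor w)

/-- A distorted disk in `E²` or `H²`: a map of the closed unit disk, continuous up to the
boundary, which is an orientation preserving `C¹` immersion of the open disk. -/
structure IsDistortedDisk (G : PlaneGeometry) (F : ℂ → ℂ) : Prop where
  continuousOn : ContinuousOn F (closedBall 0 1)
  mapsTo : MapsTo F (closedBall 0 1) G.domain
  contDiffOn : ContDiffOn ℝ 1 F (ball 0 1)
  det_pos : ∀ z ∈ ball (0 : ℂ) 1, 0 < (fderiv ℝ F z).det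

/-- The area of the disk for the metric pulled back by `F`. -/
def area (G : PlaneGeometry) (F : ℂ → ℂ) : ENNReal :=
  diskArea (pullbackMetric G.factor F)

end PlaneGeometry

/-! ### The round sphere -/

/-- Euclidean three-space; `S²` is its unit sphere with the induced metric. -/
abbrev Space := EuclideanSpace ℝ (Fin 3)

namespace Sphere

/-- The round unit two-sphere. -/
def domain : Set Space := sphere 0 1

/-- The point at infinity of the projective coordinate. -/
def infinity : Space := !₂[0, 0, -1]

/-- The projective coordinate `w = (x₀ + i x₁) / (1 + x₂)` on `S² \ {infinity}`, in which the
metric of the sphere is `4 |dw|² / (1 + |w|²)²`. -/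
def coord (p : Space) : ℂ := (p 0 + p 1 * Complex.I) / (1 + p 2)

/-- The area of a subset of the sphere (total area `4π`). -/
def setArea (Ω : Set Space) : ENNReal :=
  (volume : Measure Space).toSphere (Subtype.val ⁻¹' Ω)

/-- A distorted disk in `S²`: a map of the closed unit disk, continuous up to the boundary, which
is a `C¹` immersion of the open disk, orientation preserving for the outward orientation of the
sphere, and which is injective near each boundary point. -/
structure IsDistortedDisk (F : ℂ → Space) : Prop where
  continuousOn : ContinuousOn F (closedBall 0 1)
  mapsTo : MapsTo F (closedBall 0 1) domain
  contDiffOn : ContDiffOn ℝ 1 F (ball 0 1)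
  det_pos : ∀ z ∈ ball (0 : ℂ) 1, 0 < (Matrix.of fun i j : Fin 3 =>
    (![F z, fderiv ℝ F z 1, fderiv ℝ F z Complex.I] i) j).det
  locally_injective : ∀ z ∈ sphere (0 : ℂ) 1, ∃ U ∈ 𝓝 z, InjOn F (U ∩ closedBall 0 1)

/-- The area of the disk for the metric pulled back by `F`. -/
def area (F : ℂ → Space) : ENNReal :=
  diskArea (pullbackMetric (fun _ => 1) F)

end Sphere

end DistortedDisk

end

/-!
An orientation-preserving immersion takes each value `w` with simple positive zeros of `F - w`, so
the argument principle counts the preimages of `w` in the disk by the degree of the boundary loop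
`γ - w`. The area is the integral of the number of preimages; it is finite because the winding
number of `γ` is locally integrable.

On the sphere, lift `F` to a map `Φ` into `ℂ² ∖ {0}`. If `p` represents a point `P`, then `p ∧ Φ`
has simple zeros exactly at the preimages of `P`, so the degree of `p ∧ Γ` counts them, where `Γ`
is the boundary loop of `Φ`. Two lifts of `γ` differ by a scalar loop, whose degree `d` is added to
every one of these counts. It vanishes: since `F` is injective near the boundary, the loop
`θ ↦ Γ θ ∧ Γ (θ + ε)` has degree `1` for small `ε`, while multiplying `Γ` by a scalar loop of
degree `d` adds `2 d`. Finiteness of the area follows as in the plane once a point off the curve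
has been rotated to `∞`.
-/

namespace DistortedDisk

/-! ### The degree of a loop in the punctured plane -/

/-- The `2π`-periodic function `f` is continuous, has no zero, and turns `n` times around `0`. This
is encoded by a continuous logarithm of `f` which increases by `2πi n` over a period. -/
def HasDegree (f : ℝ → ℂ) (n : ℤ) : Prop :=
  ∃ g : ℝ → ℂ, Continuous g ∧ (∀ θ, f θ = Complex.exp (g θ)) ∧
    ∀ θ, g (θ + 2 * π) = g θ + n * (2 * π * Complex.I)

lemma eq_of_continuous_of_exp_eq {X : Type*} [TopologicalSpace X] [PreconnectedSpace X]
    {g : X → ℂ} (hg : Continuous g) (h : ∀ x y, Complex.exp (g x) = Complex.exp (g y)) (x y : X) :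
    g x = g y :=
  Complex.isCoveringMap_exp.const_of_comp hg (fun x y => Subtype.ext (h x y)) x y

namespace HasDegree

variable {f g : ℝ → ℂ} {m n : ℤ}

lemma continuous (hf : HasDegree f n) : Continuous f := by
  obtain ⟨g, hg, hexp, -⟩ := hf
  rw [funext hexp]
  fun_prop

lemma ne_zero (hf : HasDegree f n) (θ : ℝ) : f θ ≠ 0 := by
  obtain ⟨g, -, hexp, -⟩ := hf
  rw [hexp]
  exact Complex.exp_ne_zero _

lemma periodic (hf : HasDegree f n) : Function.Periodic f (2 * π) := fun θ => by
  obtain ⟨g, -, hexp, hstep⟩ := hf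
  rw [hexp, hexp, hstep, Complex.exp_add, Complex.exp_int_mul_two_pi_mul_I, mul_one]

lemma mul (hf : HasDegree f m) (hg : HasDegree g n) : HasDegree (fun θ => f θ * g θ) (m + n) := by
  obtain ⟨a, ha, hexpa, hstepa⟩ := hf
  obtain ⟨b, hb, hexpb, hstepb⟩ := hg
  refine ⟨fun θ => a θ + b θ, ha.add hb, fun θ => ?_, fun θ => ?_⟩
  · simp only [hexpa, hexpb, Complex.exp_add]
  · simp only [hstepa, hstepb]
    push_cast
    ring

lemma inv (hf : HasDegree f m) : HasDegree (fun θ => (f θ)⁻¹) (-m) := by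
  obtain ⟨a, ha, hexp, hstep⟩ := hf
  refine ⟨fun θ => -a θ, ha.neg, fun θ => ?_, fun θ => ?_⟩
  · simp only [hexp, Complex.exp_neg]
  · simp only [hstep]
    push_cast
    ring

lemma div (hf : HasDegree f m) (hg : HasDegree g n) : HasDegree (fun θ => f θ / g θ) (m - n) := by
  simpa only [div_eq_mul_inv, sub_eq_add_neg] using hf.mul hg.inv

lemma comp (hf : HasDegree f n) {φ : ℝ → ℝ} (hφ : Continuous φ)
    (hφ' : ∀ θ, φ (θ + 2 * π) = φ θ + 2 * π) : HasDegree (fun θ => f (φ θ)) n := by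
  obtain ⟨g, hg, hexp, hstep⟩ := hf
  exact ⟨fun θ => g (φ θ), hg.comp hφ, fun θ => hexp _, fun θ => by simp only [hφ', hstep]⟩

lemma const {c : ℂ} (hc : c ≠ 0) : HasDegree (fun _ => c) 0 :=
  ⟨fun _ => Complex.log c, continuous_const, fun _ => (Complex.exp_log hc).symm, by simp⟩

lemma exp_mul_I : HasDegree (fun θ => Complex.exp (θ * Complex.I)) 1 :=
  ⟨fun θ => θ * Complex.I, by fun_prop, fun _ => rfl, fun θ => by push_cast; ring⟩

lemma unique (hf : HasDegree f m) (hg : HasDegree f n) : m = n := by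
  obtain ⟨g, hg, hexp, hstep⟩ := hf.div hg
  have hexp_one : ∀ θ, Complex.exp (g θ) = 1 := fun θ => by
    rw [← hexp]
    exact div_self (hf.ne_zero θ)
  have hper : g (0 + 2 * π) = g 0 :=
    eq_of_continuous_of_exp_eq hg (fun θ θ' => by rw [hexp_one, hexp_one]) _ _
  rw [hstep, add_eq_left, mul_eq_zero, or_iff_left Complex.two_pi_I_ne_zero] at hper
  exact sub_eq_zero.1 (by exact_mod_cast hper)

lemma of_mem_slitPlane (hf : Continuous f) (hp : Function.Periodic f (2 * π))
    (h : ∀ θ, f θ ∈ Complex.slitPlane) : HasDegree f 0 :=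
  ⟨fun θ => Complex.log (f θ), hf.clog h,
    fun θ => (Complex.exp_log (Complex.slitPlane_ne_zero (h θ))).symm, fun θ => by simp [hp θ]⟩

lemma of_norm_sub_lt (hg : HasDegree g n) (hf : Continuous f) (hp : Function.Periodic f (2 * π))
    (h : ∀ θ, ‖f θ - g θ‖ < ‖g θ‖) : HasDegree f n := by
  have hquot : HasDegree (fun θ => f θ / g θ) 0 := by
    refine of_mem_slitPlane (hf.div hg.continuous hg.ne_zero)
      (fun θ => by rw [hp θ, hg.periodic θ]) fun θ => ?_
    have hlt : ‖f θ / g θ - 1‖ < 1 := by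
      rw [div_sub_one (hg.ne_zero θ), norm_div, div_lt_one (norm_pos_iff.2 (hg.ne_zero θ))]
      exact h θ
    rw [← add_sub_cancel 1 (f θ / g θ)]
    exact Complex.mem_slitPlane_of_norm_lt_one hlt
  simpa only [div_mul_cancel₀ _ (hg.ne_zero _), zero_add] using hquot.mul hg

end HasDegree

lemma exists_hasDegree {f : ℝ → ℂ} (hf : Continuous f) (hp : Function.Periodic f (2 * π))
    (h0 : ∀ θ, f θ ≠ 0) : ∃ n, HasDegree f n := by
  obtain ⟨g, ⟨-, hlift⟩, -⟩ := Complex.isCoveringMapOn_exp.existsUnique_continuousMap_lifts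
    ⟨f, hf⟩ (Complex.exp_log (h0 0)) h0
  have hexp : ∀ θ, Complex.exp (g θ) = f θ := congr_fun hlift
  have hjump : ∀ θ, Complex.exp (g (θ + 2 * π) - g θ) = 1 := fun θ => by
    rw [Complex.exp_sub, hexp, hexp, hp θ, div_self (h0 θ)]
  obtain ⟨n, hn⟩ := Complex.exp_eq_one_iff.1 (hjump 0)
  refine ⟨n, g, g.continuous, fun θ => (hexp θ).symm, fun θ => ?_⟩
  have hconst : g (θ + 2 * π) - g θ = g (0 + 2 * π) - g 0 :=
    eq_of_continuous_of_exp_eq (g := fun θ => g (θ + 2 * π) - g θ) (by fun_prop)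
      (fun x y => by rw [hjump, hjump]) θ 0
  rw [← hn, ← hconst, add_sub_cancel]

lemma forall_of_periodic_of_forall_mem_Icc {p : ℝ → Prop} {T : ℝ} (hT : 0 < T)
    (hp : Function.Periodic p T) (h : ∀ θ ∈ Icc 0 T, p θ) (θ : ℝ) : p θ := by
  obtain ⟨θ', hθ', heq⟩ := hp.exists_mem_Ico₀ hT θ
  rw [heq]
  exact h θ' (Ico_subset_Icc_self hθ')

section Homotopy

variable {X : Type*} {H : X → ℝ → ℂ}

lemma HasDegree.eventually {l : Filter X} {f : ℝ → ℂ} {n : ℤ} (hf : HasDegree f n)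
    (hc : ∀ᶠ x in l, Continuous (H x)) (hp : ∀ᶠ x in l, Function.Periodic (H x) (2 * π))
    (ht : ∀ θ, Filter.Tendsto (Function.uncurry H) (l ×ˢ 𝓝 θ) (𝓝 (f θ))) :
    ∀ᶠ x in l, HasDegree (H x) n := by
  have hclose : {q : X × ℝ | ‖H q.1 q.2 - f q.2‖ < ‖f q.2‖} ∈ l ×ˢ 𝓝ˢ (Icc 0 (2 * π)) := by
    refine isCompact_Icc.mem_prod_nhdsSet_of_forall fun θ _ => ?_
    have hfθ : Filter.Tendsto (fun q : X × ℝ => f q.2) (l ×ˢ 𝓝 θ) (𝓝 (f θ)) :=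
      (hf.continuous.tendsto θ).comp Filter.tendsto_snd
    refine ((ht θ).sub hfθ).norm.eventually_lt hfθ.norm ?_
    rw [sub_self, norm_zero]
    exact norm_pos_iff.2 (hf.ne_zero θ)
  filter_upwards [(Filter.Eventually.curry hclose).mono fun _ h => h.self_of_nhdsSet, hc, hp]
    with x hx hxc hxp
  exact hf.of_norm_sub_lt hxc hxp (forall_of_periodic_of_forall_mem_Icc Real.two_pi_pos
    (fun θ => by rw [hxp θ, hf.periodic θ]) hx)

lemma HasDegree.of_isPreconnected [TopologicalSpace X] {S : Set X} (hS : IsPreconnected S)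
    (hH : ContinuousOn (Function.uncurry H) (S ×ˢ univ))
    (hp : ∀ x ∈ S, Function.Periodic (H x) (2 * π)) (h0 : ∀ x ∈ S, ∀ θ, H x θ ≠ 0)
    {x y : X} (hx : x ∈ S) (hy : y ∈ S) {n : ℤ} (hn : HasDegree (H x) n) : HasDegree (H y) n := by
  have hc : ∀ x ∈ S, Continuous (H x) := fun x hx =>
    hH.comp_continuous (f := fun θ : ℝ => (x, θ)) (by fun_prop) fun θ => ⟨hx, mem_univ θ⟩
  choose! d hd using fun x (hx : x ∈ S) => exists_hasDegree (hc x hx) (hp x hx) (h0 x hx)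
  have hdc : ContinuousOn d S := by
    intro x hx
    have hev : ∀ᶠ y in 𝓝[S] x, HasDegree (H y) (d x) := by
      refine (hd x hx).eventually ?_ ?_ fun θ => ?_
      · filter_upwards [self_mem_nhdsWithin] using hc
      · filter_upwards [self_mem_nhdsWithin] using hp
      · have hHθ : ContinuousWithinAt (Function.uncurry H) (S ×ˢ univ) (x, θ) :=
          hH _ ⟨hx, mem_univ _⟩
        rwa [ContinuousWithinAt, nhdsWithin_prod_eq, nhdsWithin_univ] at hHθ
    refine (continuousWithinAt_const (b := d x)).congr_of_eventuallyEq ?_ rfl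
    filter_upwards [hev, self_mem_nhdsWithin] with y hy hyS using (hd y hyS).unique hy
  rw [(hd x hx).unique hn |>.symm, hS.constant hdc hx hy]
  exact hd y hy

end Homotopy

/-! ### Simple zeros and the argument principle -/

/-- Along the filter `l`, the function `f` equals a nonzero multiple of `u` up to a relative error
bounded away from `1`. With `u z = z - z₀` this is the form in which orientation preserving linear
isomorphisms enter the degree computations, see `IsSimpleZero`. -/
def IsNearMultiple {X : Type*} (f u : X → ℂ) (l : Filter X) : Prop :=
  ∃ a : ℂ, a ≠ 0 ∧ ∃ c < (1 : ℝ), ∀ᶠ x in l, ‖f x - a * u x‖ ≤ c * ‖a * u x‖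

lemma eq_zero_of_norm_sub_le {x y : ℂ} {c : ℝ} (hc : c < 1) (h : ‖x - y‖ ≤ c * ‖y‖)
    (hx : x = 0) : y = 0 := by
  rw [hx, zero_sub, norm_neg] at h
  exact norm_le_zero_iff.1 (by nlinarith [norm_nonneg y])

namespace IsNearMultiple

variable {X Y : Type*} {f u : X → ℂ} {l : Filter X}

lemma eventually_eq_zero (h : IsNearMultiple f u l) : ∀ᶠ x in l, f x = 0 → u x = 0 := by
  obtain ⟨a, ha, c, hc, h⟩ := h
  filter_upwards [h] with x hx hfx
  exact (mul_eq_zero.1 (eq_zero_of_norm_sub_le hc hx hfx)).resolve_left ha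

lemma comp_tendsto (h : IsNearMultiple f u l) {φ : Y → X} {l' : Filter Y}
    (hφ : Filter.Tendsto φ l' l) : IsNearMultiple (f ∘ φ) (u ∘ φ) l' := by
  obtain ⟨a, ha, c, hc, h⟩ := h
  exact ⟨a, ha, c, hc, hφ.eventually h⟩

lemma congr (h : IsNearMultiple f u l) {g : X → ℂ} (hgf : g =ᶠ[l] f) : IsNearMultiple g u l := by
  obtain ⟨a, ha, c, hc, h⟩ := h
  refine ⟨a, ha, c, hc, ?_⟩
  filter_upwards [h, hgf] with x hx heq
  rwa [heq]

lemma mul (h : IsNearMultiple f u l) {k : X → ℂ} {k₀ : ℂ} (hk : Filter.Tendsto k l (𝓝 k₀))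
    (hk₀ : k₀ ≠ 0) : IsNearMultiple (fun x => k x * f x) u l := by
  obtain ⟨a, ha, c, hc, h⟩ := h
  have hk₀' : 0 < ‖k₀‖ := norm_pos_iff.2 hk₀
  have hlim : Filter.Tendsto (fun x => ‖k x‖ * c + ‖k x - k₀‖) l (𝓝 (‖k₀‖ * c)) := by
    simpa using (hk.norm.mul_const c).add (hk.sub_const k₀).norm
  have herr : ∀ᶠ x in l, ‖k x‖ * c + ‖k x - k₀‖ < (c + 1) / 2 * ‖k₀‖ :=
    hlim.eventually (gt_mem_nhds (by nlinarith))
  refine ⟨k₀ * a, mul_ne_zero hk₀ ha, (c + 1) / 2, by linarith, ?_⟩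
  filter_upwards [h, herr] with x hx hkx
  calc ‖k x * f x - k₀ * a * u x‖
      = ‖k x * (f x - a * u x) + (k x - k₀) * (a * u x)‖ := by ring_nf
    _ ≤ ‖k x‖ * (c * ‖a * u x‖) + ‖k x - k₀‖ * ‖a * u x‖ := by
        refine (norm_add_le _ _).trans ?_
        rw [norm_mul, norm_mul]
        gcongr
    _ = (‖k x‖ * c + ‖k x - k₀‖) * ‖a * u x‖ := by ring
    _ ≤ (c + 1) / 2 * ‖k₀‖ * ‖a * u x‖ := by gcongr
    _ = (c + 1) / 2 * ‖k₀ * a * u x‖ := by rw [mul_assoc k₀, norm_mul k₀]; ring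

end IsNearMultiple

lemma det_eq_re_mul_im_sub (L : ℂ →L[ℝ] ℂ) :
    L.det = (L 1).re * (L Complex.I).im - (L Complex.I).re * (L 1).im := by
  rw [ContinuousLinearMap.det, ← LinearMap.det_toMatrix Complex.basisOneI, Matrix.det_fin_two]
  simp [LinearMap.toMatrix_apply]

lemma exists_eq_mul_add_mul_conj (L : ℂ →L[ℝ] ℂ) :
    ∃ a b : ℂ, (∀ u, L u = a * u + b * starRingEnd ℂ u) ∧ L.det = ‖a‖ ^ 2 - ‖b‖ ^ 2 := by
  set p := L 1
  set q := L Complex.I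
  have hL : ∀ u : ℂ, L u = u.re * p + u.im * q := fun u => by
    conv_lhs => rw [show u = u.re • (1 : ℂ) + u.im • Complex.I by simp [Complex.re_add_im]]
    rw [map_add, map_smul, map_smul, Complex.real_smul, Complex.real_smul]
  refine ⟨(p - Complex.I * q) / 2, (p + Complex.I * q) / 2, fun u => ?_, ?_⟩
  · rw [hL]
    apply Complex.ext <;> simp <;> ring
  · rw [det_eq_re_mul_im_sub, ← Complex.normSq_eq_norm_sq, ← Complex.normSq_eq_norm_sq,
      Complex.normSq_div, Complex.normSq_div, Complex.normSq_apply (p - _),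
      Complex.normSq_apply (p + _)]
    simp [p, q]
    ring

lemma IsNearMultiple.of_isLittleO {X : Type*} {f u : X → ℂ} {l : Filter X} {L : ℂ →L[ℝ] ℂ}
    (hL : 0 < L.det) (h : (fun x => f x - L (u x)) =o[l] u) : IsNearMultiple f u l := by
  obtain ⟨a, b, hab, hdet⟩ := exists_eq_mul_add_mul_conj L
  have hba : ‖b‖ < ‖a‖ := lt_of_pow_lt_pow_left₀ 2 (norm_nonneg a) (by linarith)
  have ha : 0 < ‖a‖ := (norm_nonneg b).trans_lt hba
  refine ⟨a, norm_pos_iff.1 ha, ((‖a‖ + ‖b‖) / 2) / ‖a‖, by rw [div_lt_one ha]; linarith, ?_⟩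
  filter_upwards [h.def (c := (‖a‖ - ‖b‖) / 2) (by linarith)] with x hx
  calc ‖f x - a * u x‖ = ‖(f x - L (u x)) + b * starRingEnd ℂ (u x)‖ := by
        rw [hab]
        ring_nf
    _ ≤ (‖a‖ - ‖b‖) / 2 * ‖u x‖ + ‖b‖ * ‖u x‖ := by
        refine (norm_add_le _ _).trans ?_
        rw [norm_mul, RCLike.norm_conj]
        gcongr
    _ = (‖a‖ + ‖b‖) / 2 / ‖a‖ * ‖a * u x‖ := by
        rw [norm_mul, ← mul_assoc, div_mul_cancel₀ _ ha.ne']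
        ring

/-- `z₀` is a zero of `f`, near which `f` winds around `0` like an orientation preserving real
linear isomorphism. No differentiability is required, so that the notion is stable under
multiplication by continuous functions. -/
def IsSimpleZero (f : ℂ → ℂ) (z₀ : ℂ) : Prop :=
  IsNearMultiple f (fun z => z - z₀) (𝓝 z₀)

namespace IsSimpleZero

variable {f g : ℂ → ℂ} {z₀ : ℂ}

lemma of_hasFDerivAt {L : ℂ →L[ℝ] ℂ} (hf : HasFDerivAt f L z₀) (h0 : f z₀ = 0) (hL : 0 < L.det) :
    IsSimpleZero f z₀ :=
  IsNearMultiple.of_isLittleO hL (by simpa [h0] using hf.isLittleO)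

lemma eventually_ne (h : IsSimpleZero f z₀) : ∀ᶠ z in 𝓝 z₀, f z = 0 → z = z₀ := by
  filter_upwards [h.eventually_eq_zero] with z hz hfz using sub_eq_zero.1 (hz hfz)

lemma mul (hf : IsSimpleZero f z₀) {k : ℂ → ℂ} (hk : ContinuousAt k z₀) (hk₀ : k z₀ ≠ 0) :
    IsSimpleZero (fun z => k z * f z) z₀ :=
  IsNearMultiple.mul hf hk hk₀

lemma congr (hf : IsSimpleZero f z₀) (h : g =ᶠ[𝓝 z₀] f) : IsSimpleZero g z₀ :=
  IsNearMultiple.congr hf h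

/-- A bump function interpolates between `f` near `z₀` and its linear part away from `z₀`. -/
lemma exists_eventuallyEq (h : IsSimpleZero f z₀) {S U : Set ℂ} (hf : ContinuousOn f S)
    (hU : U ∈ 𝓝 z₀) : ∃ k : ℂ → ℂ, ContinuousOn k S ∧ k =ᶠ[𝓝 z₀] f ∧ (∀ z, k z = 0 → z = z₀) ∧
      ∃ V ⊆ U, IsClosed V ∧ (∀ z ∈ V, f z = 0 → z = z₀) ∧
        ∃ a ≠ 0, ∀ z ∉ V, k z = a * (z - z₀) := by
  obtain ⟨a, ha, c, hc, hac⟩ := h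
  obtain ⟨ε, hε, hball⟩ := Metric.nhds_basis_closedBall.mem_iff.1 (Filter.inter_mem hac hU)
  let χ : ContDiffBump z₀ := ⟨ε / 2, ε, half_pos hε, half_lt_self hε⟩
  have hlin : ∀ z, a * (z - z₀) = 0 → z = z₀ := fun z hz =>
    sub_eq_zero.1 ((mul_eq_zero.1 hz).resolve_left ha)
  refine ⟨fun z => χ z * f z + (1 - χ z) * (a * (z - z₀)), ?_, ?_, fun z hz => ?_,
    closedBall z₀ ε, hball.trans inter_subset_right, isClosed_closedBall,
    fun z hz hfz => hlin z (eq_zero_of_norm_sub_le hc (hball hz).1 hfz), a, ha, fun z hz => ?_⟩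
  · have hχ : Continuous fun z => (χ z : ℂ) := Complex.continuous_ofReal.comp χ.continuous
    exact (hχ.continuousOn.mul hf).add ((continuous_const.sub hχ).mul (by fun_prop)).continuousOn
  · filter_upwards [χ.eventuallyEq_one] with z hz
    simp [hz]
  · by_cases hzε : z ∈ closedBall z₀ ε
    · refine hlin z (eq_zero_of_norm_sub_le hc ?_ hz)
      calc _ = ‖(χ z : ℂ) * (f z - a * (z - z₀))‖ := by ring_nf
        _ ≤ 1 * ‖f z - a * (z - z₀)‖ := by
          rw [norm_mul, Complex.norm_of_nonneg χ.nonneg]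
          gcongr
          exact χ.le_one
        _ ≤ c * ‖a * (z - z₀)‖ := by
          rw [one_mul]
          exact (hball hzε).1
    · exact hlin z (by simpa [χ.zero_of_le_dist (not_le.1 hzε).le] using hz)
  · simp [χ.zero_of_le_dist (not_le.1 hz).le]

lemma exists_eq_mul (h : IsSimpleZero f z₀) {S U : Set ℂ} (hf : ContinuousOn f S)
    (hU : U ∈ 𝓝 z₀) : ∃ g : ℂ → ℂ, ContinuousOn g S ∧
      (∃ a ≠ 0, ∀ z ∉ U, f z = g z * (a * (z - z₀))) ∧ (∀ z, g z = 0 ↔ f z = 0 ∧ z ≠ z₀) ∧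
      ∀ z, f z = 0 → z ≠ z₀ → IsSimpleZero f z → IsSimpleZero g z := by
  classical
  obtain ⟨k, hk, hkf, hk0, V, hVU, hV, hVf, a, ha, hkV⟩ := h.exists_eventuallyEq hf hU
  set g : ℂ → ℂ := Function.update (fun z => f z / k z) z₀ 1 with hg
  have hgz : ∀ z, z ≠ z₀ → g z = f z / k z := fun z hz => Function.update_of_ne hz _ _
  have hgz₀ : g =ᶠ[𝓝 z₀] fun _ => 1 := by
    filter_upwards [hkf, h.eventually_ne] with z hkz hfz
    rcases eq_or_ne z z₀ with rfl | hz
    · simp [hg]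
    · rw [hgz z hz, hkz, div_self fun h0 => hz (hfz h0)]
  refine ⟨g, fun z hz => ?_, ⟨a, ha, fun z hz => ?_⟩, fun z => ?_, fun z hfz hz hs => ?_⟩
  · rcases eq_or_ne z z₀ with rfl | hne
    · exact (continuousAt_const.congr hgz₀.symm).continuousWithinAt
    · refine ((hf z hz).div (hk z hz) fun h0 => hne (hk0 z h0)).congr_of_eventuallyEq ?_ (hgz z hne)
      filter_upwards [nhdsWithin_le_nhds (isOpen_ne.mem_nhds hne)] with w hw using hgz w hw
  · have hz₀ : z ≠ z₀ := fun heq => hz (heq ▸ mem_of_mem_nhds hU)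
    have hzV := hkV z fun hzV => hz (hVU hzV)
    rw [hgz z hz₀, ← hzV, div_mul_cancel₀ _ fun h0 => hz₀ (hk0 z h0)]
  · rcases eq_or_ne z z₀ with rfl | hne
    · simp [hg]
    · rw [hgz z hne, div_eq_zero_iff, or_iff_left fun h0 => hne (hk0 z h0)]
      exact (and_iff_left hne).symm
  · have hzV : z ∉ V := fun hzV => hz (hVf z hzV hfz)
    have hlin : a * (z - z₀) ≠ 0 := mul_ne_zero ha (sub_ne_zero.2 hz)
    refine (hs.mul (k := fun w => (a * (w - z₀))⁻¹) (ContinuousAt.inv₀ (by fun_prop) hlin)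
      (inv_ne_zero hlin)).congr ?_
    filter_upwards [hV.isOpen_compl.mem_nhds hzV, isOpen_ne.mem_nhds hz] with w hwV hw
    rw [hgz w hw, hkV w hwV, div_eq_inv_mul]

end IsSimpleZero

lemma exp_mul_I_mem_sphere (θ : ℝ) : Complex.exp (θ * Complex.I) ∈ sphere (0 : ℂ) 1 := by
  simp [Complex.norm_exp_ofReal_mul_I]

lemma HasDegree.exp_mul_I_sub {z₀ : ℂ} (hz₀ : z₀ ∈ ball (0 : ℂ) 1) :
    HasDegree (fun θ => Complex.exp (θ * Complex.I) - z₀) 1 :=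
  HasDegree.exp_mul_I.of_norm_sub_lt (by fun_prop)
    (fun θ => congrArg (· - z₀) (HasDegree.exp_mul_I.periodic θ))
    fun θ => by simpa [Complex.norm_exp_ofReal_mul_I] using hz₀

section ArgumentPrinciple

variable {f : ℂ → ℂ}

lemma hasDegree_zero_of_forall_ne_zero (hf : ContinuousOn f (closedBall 0 1))
    (h0 : ∀ z ∈ closedBall (0 : ℂ) 1, f z ≠ 0) :
    HasDegree (fun θ => f (Complex.exp (θ * Complex.I))) 0 := by
  have hmem : ∀ t ∈ Icc (0 : ℝ) 1, ∀ θ : ℝ,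
      (t : ℂ) * Complex.exp (θ * Complex.I) ∈ closedBall (0 : ℂ) 1 := fun t ht θ => by
    simpa [Complex.norm_exp_ofReal_mul_I, abs_of_nonneg ht.1] using ht.2
  have hcenter : HasDegree (fun θ => f ((0 : ℝ) * Complex.exp (θ * Complex.I))) 0 := by
    simpa using HasDegree.const (h0 0 (by simp))
  simpa using HasDegree.of_isPreconnected isPreconnected_Icc
    (H := fun (t : ℝ) (θ : ℝ) => f (t * Complex.exp (θ * Complex.I)))
    (hf.comp (by fun_prop) fun q hq => hmem _ hq.1 _)
    (fun t _ θ => by simp only [HasDegree.exp_mul_I.periodic θ])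
    (fun t ht θ => h0 _ (hmem t ht θ)) (left_mem_Icc.2 zero_le_one) (right_mem_Icc.2 zero_le_one)
    hcenter

lemma finite_zeros (hf : ContinuousOn f (closedBall 0 1)) (hs : ∀ z ∈ sphere (0 : ℂ) 1, f z ≠ 0)
    (h : ∀ z ∈ ball (0 : ℂ) 1, f z = 0 → IsSimpleZero f z) :
    {z ∈ ball (0 : ℂ) 1 | f z = 0}.Finite := by
  have heq : {z ∈ ball (0 : ℂ) 1 | f z = 0} = closedBall 0 1 ∩ f ⁻¹' {0} := by
    ext z
    refine ⟨fun hz => ⟨ball_subset_closedBall hz.1, hz.2⟩, fun hz => ⟨?_, hz.2⟩⟩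
    rw [← ball_union_sphere] at hz
    exact hz.1.resolve_right fun hzs => hs z hzs hz.2
  have hcompact : IsCompact {z ∈ ball (0 : ℂ) 1 | f z = 0} := by
    rw [heq]
    exact (isCompact_closedBall 0 1).of_isClosed_subset
      (hf.preimage_isClosed_of_isClosed isClosed_closedBall isClosed_singleton) inter_subset_left
  by_contra hinf
  obtain ⟨z, hz, hacc⟩ := Set.Infinite.exists_accPt_of_subset_isCompact hinf hcompact subset_rfl
  rw [accPt_iff_frequently] at hacc
  exact hacc ((h z hz.1 hz.2).eventually_ne.mono fun w hw hwz => hwz.1 (hw hwz.2.2))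

theorem hasDegree_ncard_zeros (hf : ContinuousOn f (closedBall 0 1))
    (hs : ∀ z ∈ sphere (0 : ℂ) 1, f z ≠ 0)
    (h : ∀ z ∈ ball (0 : ℂ) 1, f z = 0 → IsSimpleZero f z) :
    HasDegree (fun θ => f (Complex.exp (θ * Complex.I))) {z ∈ ball (0 : ℂ) 1 | f z = 0}.ncard := by
  induction hn : {z ∈ ball (0 : ℂ) 1 | f z = 0}.ncard generalizing f with
  | zero =>
    rw [Set.ncard_eq_zero (finite_zeros hf hs h)] at hn
    refine hasDegree_zero_of_forall_ne_zero hf fun z hz hfz => ?_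
    rw [← ball_union_sphere] at hz
    exact hz.elim (fun hz => hn.subset ⟨hz, hfz⟩) fun hz => hs z hz hfz
  | succ n ih =>
    obtain ⟨z₀, hz₀, hfz₀⟩ : {z ∈ ball (0 : ℂ) 1 | f z = 0}.Nonempty := by
      rw [← Set.ncard_pos (finite_zeros hf hs h), hn]
      omega
    obtain ⟨g, hg, ⟨a, ha, hfg⟩, hg0, hgs⟩ :=
      (h z₀ hz₀ hfz₀).exists_eq_mul hf (isOpen_ball.mem_nhds hz₀)
    have hzeros : {z ∈ ball (0 : ℂ) 1 | g z = 0} = {z ∈ ball (0 : ℂ) 1 | f z = 0} \ {z₀} := by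
      ext z
      simp only [mem_ofPred_eq, mem_sdiff, mem_singleton_iff, and_assoc, hg0]
    have hcard : {z ∈ ball (0 : ℂ) 1 | g z = 0}.ncard = n := by
      rw [hzeros, Set.ncard_sdiff_singleton_of_mem (by exact ⟨hz₀, hfz₀⟩), hn, Nat.add_sub_cancel]
    have hdeg : HasDegree (fun θ => g (Complex.exp (θ * Complex.I))) n :=
      ih hg (fun z hz hgz => hs z hz ((hg0 z).1 hgz).1)
        (fun z hz hgz => hgs z ((hg0 z).1 hgz).1 ((hg0 z).1 hgz).2 (h z hz ((hg0 z).1 hgz).1)) hcard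
    have hsphere : ∀ θ : ℝ, Complex.exp (θ * Complex.I) ∉ ball (0 : ℂ) 1 := fun θ =>
      disjoint_left.1 sphere_disjoint_ball (exp_mul_I_mem_sphere θ)
    simp only [hfg _ (hsphere _)]
    exact_mod_cast hdeg.mul ((HasDegree.const ha).mul (HasDegree.exp_mul_I_sub hz₀))

end ArgumentPrinciple

/-! ### Closed curves -/

lemma addHaar_image_eq_zero_of_finrank_lt {E F : Type*} [NormedAddCommGroup E] [NormedSpace ℝ E]
    [FiniteDimensional ℝ E] [NormedAddCommGroup F] [NormedSpace ℝ F] [FiniteDimensional ℝ F]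
    [MeasurableSpace F] [BorelSpace F] (μ : Measure F) [μ.IsAddHaarMeasure] {f : E → F} {s : Set E}
    (hf : ContDiffOn ℝ 1 f s) (hs : Convex ℝ s) (h : Module.finrank ℝ E < Module.finrank ℝ F) :
    μ (f '' s) = 0 := by
  refine measure_zero_of_dimH_lt (d := Module.finrank ℝ F) ?_ ?_
  · rw [NNReal.coe_natCast]
    exact Measure.absolutelyContinuous_isAddHaarMeasure _ _
  · calc dimH (f '' s) ≤ dimH (univ : Set E) :=
          (hf.dimH_image_le hs subset_rfl).trans (dimH_mono (subset_univ s))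
      _ < Module.finrank ℝ F := by
          rw [Real.dimH_univ_eq_finrank]
          exact_mod_cast h

lemma integrableOn_ball_norm_inv (R : ℝ) : IntegrableOn (fun w : ℂ => ‖w‖⁻¹) (ball 0 R) :=
  integrableOn_ball_of_norm_le_rpow (C := 1) (α := 1) (by simp) (by simp)
    (.of_forall fun w => by simp [Real.rpow_neg_one]) (by fun_prop)

lemma hasDerivAt_of_exp_eq {f g : ℝ → ℂ} {f' : ℂ} {θ : ℝ} (hg : ContinuousAt g θ)
    (h : ∀ u, f u = Complex.exp (g u)) (hf : HasDerivAt f f' θ) : HasDerivAt g (f' / f θ) θ := by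
  have hexp := Complex.hasStrictDerivAt_exp (g θ)
  have hlog := (hexp.to_localInverse (Complex.exp_ne_zero _)).hasDerivAt.scomp_of_eq θ hf (h θ).symm
  rw [smul_eq_mul, ← div_eq_mul_inv] at hlog
  rw [h θ]
  refine hlog.congr_of_eventuallyEq ?_
  filter_upwards [hg.eventually (hexp.eventually_left_inverse (Complex.exp_ne_zero _))] with u hu
  rw [Function.comp_apply, h, hu]

namespace IsClosedCurve

section

variable {E : Type*} [NormedAddCommGroup E] [NormedSpace ℝ E] {γ : ℝ → E}

lemma isCompact_range (hγ : IsClosedCurve γ) : IsCompact (range γ) := by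
  rw [← Function.Periodic.image_Icc hγ.periodic Real.two_pi_pos 0]
  exact isCompact_Icc.image hγ.continuous

lemma exists_Ioc_eq_biUnion (hγ : IsClosedCurve γ) : ∃ (n : ℕ) (t : ℕ → ℝ),
    Ioc 0 (2 * π) = ⋃ i ∈ Ico 0 n, Ioc (t i) (t (i + 1)) ∧
      ∀ i ∈ Ico 0 n, ContDiffOn ℝ 1 γ (Icc (t i) (t (i + 1))) := by
  obtain ⟨n, t, ht, h0, hn, h⟩ := hγ.piecewise
  exact ⟨n, t, by rw [← h0, ← hn]; exact (ht.biUnion_Ico_Ioc_map_succ 0 n).symm,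
    fun i hi => h i hi.2⟩

lemma exists_range_eq_biUnion (hγ : IsClosedCurve γ) : ∃ (n : ℕ) (t : ℕ → ℝ),
    range γ = ⋃ i ∈ Ico 0 n, γ '' Ioc (t i) (t (i + 1)) ∧
      ∀ i ∈ Ico 0 n, ContDiffOn ℝ 1 γ (Ioc (t i) (t (i + 1))) := by
  obtain ⟨n, t, ht, h⟩ := hγ.exists_Ioc_eq_biUnion
  refine ⟨n, t, ?_, fun i hi => (h i hi).mono Ioc_subset_Icc_self⟩
  rw [← Function.Periodic.image_Ioc hγ.periodic Real.two_pi_pos 0, zero_add, ht, image_iUnion₂]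

lemma exists_norm_deriv_le (hγ : IsClosedCurve γ) : ∃ (s : Set ℝ) (C : NNReal), s.Countable ∧
    ∀ θ ∈ Ioc 0 (2 * π) \ s, DifferentiableAt ℝ γ θ ∧ ‖deriv γ θ‖ ≤ C := by
  obtain ⟨n, t, ht, h⟩ := hγ.exists_Ioc_eq_biUnion
  have hpiece : ∀ i ∈ Ico 0 n, ∃ C : NNReal, ∀ θ ∈ Ioo (t i) (t (i + 1)),
      DifferentiableAt ℝ γ θ ∧ ‖deriv γ θ‖ ≤ C := by
    intro i hi
    rcases le_or_gt (t (i + 1)) (t i) with hle | hlt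
    · exact ⟨0, fun θ hθ => (hle.not_gt (hθ.1.trans hθ.2)).elim⟩
    · obtain ⟨C, hC⟩ := isCompact_Icc.exists_bound_of_continuousOn
        ((h i hi).continuousOn_derivWithin (uniqueDiffOn_Icc hlt) le_rfl)
      refine ⟨C.toNNReal, fun θ hθ => ?_⟩
      have hnhds : Icc (t i) (t (i + 1)) ∈ 𝓝 θ := Icc_mem_nhds hθ.1 hθ.2
      refine ⟨((h i hi).differentiableOn one_ne_zero).differentiableAt hnhds, ?_⟩
      rw [← derivWithin_of_mem_nhds hnhds]
      exact (hC θ (Ioo_subset_Icc_self hθ)).trans (Real.le_coe_toNNReal C)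
  choose! C hC using hpiece
  refine ⟨range t, (Finset.range n).sup C, countable_range t, fun θ ⟨hθ, hθt⟩ => ?_⟩
  rw [ht] at hθ
  obtain ⟨i, hi, hθi⟩ := mem_iUnion₂.1 hθ
  obtain ⟨hdiff, hle⟩ := hC i hi θ ⟨hθi.1, hθi.2.lt_of_ne fun heq => hθt ⟨i + 1, heq.symm⟩⟩
  exact ⟨hdiff, hle.trans (NNReal.coe_le_coe.2 (Finset.le_sup (Finset.mem_range.2 hi.2)))⟩

lemma intervalIntegrable_deriv [CompleteSpace E] (hγ : IsClosedCurve γ) :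
    IntervalIntegrable (deriv γ) volume 0 (2 * π) := by
  obtain ⟨s, C, hs, hC⟩ := hγ.exists_norm_deriv_le
  rw [intervalIntegrable_iff_integrableOn_Ioc_of_le Real.two_pi_pos.le]
  refine Measure.integrableOn_of_bounded (M := C) measure_Ioc_lt_top.ne
    (aestronglyMeasurable_deriv γ _) ?_
  filter_upwards [ae_restrict_mem measurableSet_Ioc, ae_restrict_of_ae (hs.ae_notMem volume)]
    with θ hθ hθs using (hC θ ⟨hθ, hθs⟩).2

end

section WindingNumber

variable {γ : ℝ → ℂ}

lemma volume_range (hγ : IsClosedCurve γ) : volume (range γ) = 0 := by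
  obtain ⟨n, t, hrange, ht⟩ := hγ.exists_range_eq_biUnion
  rw [hrange, measure_biUnion_null_iff (finite_Ico 0 n).countable]
  exact fun i hi => addHaar_image_eq_zero_of_finrank_lt volume (ht i hi) (convex_Ioc _ _) (by simp)

lemma exists_hasDegree_sub (hγ : IsClosedCurve γ) {w : ℂ} (hw : w ∉ range γ) :
    ∃ n : ℤ, HasDegree (fun θ => γ θ - w) n :=
  exists_hasDegree (hγ.continuous.sub continuous_const) (fun θ => congrArg (· - w) (hγ.periodic θ))
    fun θ h => hw ⟨θ, sub_eq_zero.1 h⟩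

lemma hasDegree_sub_zero (hγ : IsClosedCurve γ) {R : ℝ} (hR : range γ ⊆ ball 0 R) {w : ℂ}
    (hw : R ≤ ‖w‖) : HasDegree (fun θ => γ θ - w) 0 := by
  have hlt : ∀ θ, ‖γ θ‖ < ‖w‖ := fun θ => (mem_ball_zero_iff.1 (hR ⟨θ, rfl⟩)).trans_le hw
  refine (HasDegree.const (neg_ne_zero.2 (norm_pos_iff.1 ((norm_nonneg _).trans_lt (hlt 0)))))
    |>.of_norm_sub_lt (hγ.continuous.sub continuous_const)
      (fun θ => congrArg (· - w) (hγ.periodic θ)) fun θ => ?_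
  rw [sub_neg_eq_add, sub_add_cancel, norm_neg]
  exact hlt θ

lemma exists_forall_hasDegree_sub (hγ : IsClosedCurve γ) {Ω : Set ℂ}
    (hΩ : Ω ∈ complementComponents univ (range γ)) :
    ∃ n : ℤ, ∀ w ∈ Ω, HasDegree (fun θ => γ θ - w) n := by
  obtain ⟨P, hP, rfl⟩ := hΩ
  obtain ⟨n, hn⟩ := hγ.exists_hasDegree_sub hP.2
  have hcont : Continuous (Function.uncurry fun (w : ℂ) (θ : ℝ) => γ θ - w) :=
    (hγ.continuous.comp continuous_snd).sub continuous_fst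
  exact ⟨n, fun w hw => hn.of_isPreconnected isPreconnected_connectedComponentIn hcont.continuousOn
    (fun w _ θ => congrArg (· - w) (hγ.periodic θ))
    (fun w hw θ h => (connectedComponentIn_subset _ _ hw).2 ⟨θ, sub_eq_zero.1 h⟩)
    (mem_connectedComponentIn hP) hw⟩

lemma windingNumber_eq (hγ : IsClosedCurve γ) {w : ℂ} {n : ℤ}
    (hn : HasDegree (fun θ => γ θ - w) n) : windingNumber γ w = n := by
  obtain ⟨g, hg, hexp, hstep⟩ := id hn
  obtain ⟨s, _, hs, hdiff⟩ := hγ.exists_norm_deriv_le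
  have hderiv : ∀ θ ∈ Ioo 0 (2 * π) \ s, HasDerivAt g (deriv γ θ / (γ θ - w)) θ := fun θ hθ =>
    hasDerivAt_of_exp_eq hg.continuousAt hexp
      ((hdiff θ ⟨Ioo_subset_Ioc_self hθ.1, hθ.2⟩).1.hasDerivAt.sub_const w)
  have hint : IntervalIntegrable (fun θ => deriv γ θ / (γ θ - w)) volume 0 (2 * π) := by
    simp only [div_eq_mul_inv]
    exact hγ.intervalIntegrable_deriv.mul_continuousOn (hn.continuous.inv₀ hn.ne_zero).continuousOn
  have hIoo : Ioo (min 0 (2 * π)) (max 0 (2 * π)) = Ioo 0 (2 * π) := by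
    rw [min_eq_left Real.two_pi_pos.le, max_eq_right Real.two_pi_pos.le]
  have hjump : g (2 * π) - g 0 = n * (2 * π * Complex.I) := by
    rw [← zero_add (2 * π), hstep, add_sub_cancel_left]
  rw [windingNumber, integral_eq_of_hasDerivAt_off_countable g _ hs hg.continuousOn
    (fun θ hθ => hderiv θ (hIoo ▸ hθ)) hint, hjump, mul_comm,
    mul_inv_cancel_right₀ Complex.two_pi_I_ne_zero]

lemma measurable_windingNumber (hγ : IsClosedCurve γ) : Measurable (windingNumber γ) := by
  have hγm := hγ.continuous.measurable
  have hmeas : Measurable fun q : ℂ × ℝ => deriv γ q.2 / (γ q.2 - q.1) := by fun_prop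
  have heq : windingNumber γ = fun w => (2 * π * Complex.I)⁻¹ *
      ∫ θ in Ioc 0 (2 * π), deriv γ θ / (γ θ - w) :=
    funext fun w => by rw [windingNumber, intervalIntegral.integral_of_le Real.two_pi_pos.le]
  rw [heq]
  exact (hmeas.stronglyMeasurable.integral_prod_right'
    (ν := volume.restrict (Ioc 0 (2 * π)))).measurable.const_mul _

lemma enorm_windingNumber_le (hγ : IsClosedCurve γ) : ∃ C : NNReal, ∀ w,
    ‖windingNumber γ w‖ₑ ≤ ∫⁻ θ in Ioc 0 (2 * π), C * ‖‖γ θ - w‖⁻¹‖ₑ := by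
  obtain ⟨s, C, hs, hC⟩ := hγ.exists_norm_deriv_le
  have hcoeff : ‖(2 * π * Complex.I : ℂ)⁻¹‖ₑ ≤ 1 := by
    rw [← ofReal_norm, ENNReal.ofReal_le_one, norm_inv]
    refine inv_le_one_of_one_le₀ ?_
    rw [show ‖(2 * π * Complex.I : ℂ)‖ = 2 * π by simp [Real.pi_pos.le]]
    linarith [Real.pi_gt_three]
  refine ⟨C, fun w => ?_⟩
  rw [windingNumber, intervalIntegral.integral_of_le Real.two_pi_pos.le, enorm_mul]
  refine (mul_le_of_le_one_left' hcoeff).trans ((enorm_integral_le_lintegral_enorm _).trans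
    (lintegral_mono_ae ?_))
  filter_upwards [ae_restrict_mem measurableSet_Ioc, ae_restrict_of_ae (hs.ae_notMem volume)]
    with θ hθ hθs
  rw [div_eq_mul_inv, enorm_mul, ← norm_inv, enorm_norm]
  exact mul_le_mul_left (enorm_le_coe.2 (hC θ ⟨hθ, hθs⟩).2) _

lemma integrableOn_windingNumber (hγ : IsClosedCurve γ) (R : ℝ) :
    IntegrableOn (windingNumber γ) (ball 0 R) := by
  obtain ⟨C, hC⟩ := hγ.enorm_windingNumber_le
  obtain ⟨M, hM⟩ := hγ.isCompact_range.isBounded.exists_norm_le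
  set I := ∫⁻ w in ball (0 : ℂ) (R + M), ‖‖w‖⁻¹‖ₑ with hI
  have htranslate : ∀ θ, ∫⁻ w in ball 0 R, (C : ENNReal) * ‖‖γ θ - w‖⁻¹‖ₑ ≤ C * I := fun θ => by
    have hsub : ball 0 R ⊆ (fun w => γ θ - w) ⁻¹' ball 0 (R + M) := fun w hw => by
      rw [mem_preimage, mem_ball_zero_iff]
      linarith [norm_sub_le (γ θ) w, hM (γ θ) ⟨θ, rfl⟩, mem_ball_zero_iff.1 hw]
    rw [lintegral_const_mul' _ _ ENNReal.coe_ne_top, hI,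
      ← (Measure.measurePreserving_sub_left volume (γ θ)).setLIntegral_comp_preimage_emb
        (MeasurableEquiv.subLeft (γ θ)).measurableEmbedding (fun w => ‖‖w‖⁻¹‖ₑ)]
    gcongr
  have hmeas : Measurable (Function.uncurry fun (w : ℂ) (θ : ℝ) =>
      (C : ENNReal) * ‖‖γ θ - w‖⁻¹‖ₑ) := by
    have := hγ.continuous.measurable
    fun_prop
  refine ⟨hγ.measurable_windingNumber.aestronglyMeasurable, ?_⟩
  calc ∫⁻ w in ball 0 R, ‖windingNumber γ w‖ₑ
      ≤ ∫⁻ w in ball 0 R, ∫⁻ θ in Ioc 0 (2 * π), C * ‖‖γ θ - w‖⁻¹‖ₑ := lintegral_mono hC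
    _ = ∫⁻ θ in Ioc 0 (2 * π), ∫⁻ w in ball 0 R, C * ‖‖γ θ - w‖⁻¹‖ₑ :=
        lintegral_lintegral_swap hmeas.aemeasurable
    _ ≤ ∫⁻ _ in Ioc 0 (2 * π), C * I := lintegral_mono htranslate
    _ < ⊤ := by
        rw [setLIntegral_const]
        exact ENNReal.mul_lt_top (ENNReal.mul_lt_top ENNReal.coe_lt_top
          (integrableOn_ball_norm_inv _).hasFiniteIntegral) measure_Ioc_lt_top

end WindingNumber

end IsClosedCurve

/-! ### Areas and numbers of layers -/

lemma exists_disjoint_injOn_cover {X E : Type*} [TopologicalSpace X] [SecondCountableTopology X]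
    [MeasurableSpace X] [OpensMeasurableSpace X] {U : Set X} (hU : IsOpen U) {F : X → E}
    (hinj : ∀ z ∈ U, ∃ V ∈ 𝓝 z, InjOn F V) :
    ∃ A : ℕ → Set X, (∀ n, MeasurableSet (A n)) ∧ Pairwise (Function.onFun Disjoint A) ∧
      ⋃ n, A n = U ∧ ∀ n, InjOn F (A n) := by
  have : Nonempty {W : Set X // IsOpen W ∧ InjOn F W} := ⟨⟨∅, isOpen_empty, injOn_empty F⟩⟩
  obtain ⟨W, hUW⟩ := (HereditarilyLindelofSpace.isLindelof U).indexed_countable_subcover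
    (fun W : {W : Set X // IsOpen W ∧ InjOn F W} => W.1) (fun W => W.2.1) fun z hz => by
      obtain ⟨V, hV, hFV⟩ := hinj z hz
      exact mem_iUnion.2 ⟨⟨interior V, isOpen_interior, hFV.mono interior_subset⟩,
        mem_interior_iff_mem_nhds.2 hV⟩
  let B : ℕ → Set X := fun n => (W n).1 ∩ U
  refine ⟨disjointed B,
    fun n => MeasurableSet.disjointed (fun n => ((W n).2.1.inter hU).measurableSet) n,
    disjoint_disjointed B, ?_, fun n =>
    (W n).2.2.mono ((disjointed_subset B n).trans inter_subset_left)⟩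
  rw [iUnion_disjointed, ← iUnion_inter, inter_eq_right]
  exact hUW

theorem lintegral_eq_lintegral_count {X E : Type*} [TopologicalSpace X] [PolishSpace X]
    [MeasurableSpace X] [BorelSpace X] [TopologicalSpace E] [T2Space E] [MeasurableSpace E]
    [BorelSpace E] {U : Set X} (hU : IsOpen U) {F : X → E} (hF : ContinuousOn F U)
    (hinj : ∀ z ∈ U, ∃ V ∈ 𝓝 z, InjOn F V) {ν : Measure X} {μ : Measure E} {J : X → ENNReal}
    (hμ : ∀ A ⊆ U, MeasurableSet A → InjOn F A → μ (F '' A) = ∫⁻ z in A, J z ∂ν) :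
    ∫⁻ z in U, J z ∂ν = ∫⁻ P, Measure.count (U ∩ F ⁻¹' {P}) ∂μ := by
  obtain ⟨A, hA, hAd, hAU, hAF⟩ := exists_disjoint_injOn_cover hU hinj
  have hsub : ∀ n, A n ⊆ U := fun n => hAU ▸ subset_iUnion A n
  have himage : ∀ n, MeasurableSet (F '' A n) := fun n =>
    (hA n).image_of_continuousOn_injOn (hF.mono (hsub n)) (hAF n)
  have hsubsing : ∀ n P, (A n ∩ F ⁻¹' {P}).Subsingleton := fun n P x hx y hy =>
    hAF n hx.1 hy.1 (hx.2.trans hy.2.symm)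
  have hind : ∀ n P, (F '' A n).indicator (fun _ => (1 : ENNReal)) P =
      Measure.count (A n ∩ F ⁻¹' {P}) := fun n P => by
    by_cases hP : P ∈ F '' A n
    · obtain ⟨z, hz, rfl⟩ := hP
      rw [indicator_of_mem (mem_image_of_mem F hz),
        (hsubsing n (F z)).eq_singleton_of_mem ⟨hz, rfl⟩, Measure.count_singleton]
    · rw [indicator_of_notMem hP,
        show A n ∩ F ⁻¹' {P} = ∅ from eq_empty_of_forall_notMem fun z hz => hP ⟨z, hz⟩,
        measure_empty]
  calc ∫⁻ z in U, J z ∂ν = ∑' n, ∫⁻ z in A n, J z ∂ν := by rw [← hAU, lintegral_iUnion hA hAd]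
    _ = ∑' n, ∫⁻ P, (F '' A n).indicator (fun _ => (1 : ENNReal)) P ∂μ := tsum_congr fun n => by
        rw [← hμ _ (hsub n) (hA n) (hAF n), lintegral_indicator_const (himage n), one_mul]
    _ = ∫⁻ P, ∑' n, (F '' A n).indicator (fun _ => (1 : ENNReal)) P ∂μ :=
        (lintegral_tsum fun n => (measurable_const.indicator (himage n)).aemeasurable).symm
    _ = ∫⁻ P, Measure.count (U ∩ F ⁻¹' {P}) ∂μ := lintegral_congr fun P => by
        simp only [hind]
        rw [← hAU, iUnion_inter, measure_iUnion
          (hAd.mono fun i j h => h.mono inter_subset_left inter_subset_left)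
          fun n => (hsubsing n P).measurableSet]

lemma count_layers {E : Type*} {F : ℂ → E} {P : E} (h : (layers F P).Finite) :
    Measure.count (layers F P) = (layers F P).ncard := by
  rw [Measure.count_apply h.measurableSet, ← h.cast_ncard_eq]
  rfl

lemma hasSum_mul_measure {E ι : Type*} [MeasurableSpace E] [Countable ι] {μ : Measure E}
    {c : E → ENNReal} {Ω : ι → Set E} {n : ι → ℕ} (hm : ∀ i, MeasurableSet (Ω i))
    (hd : Pairwise (Function.onFun Disjoint Ω)) (hc : ∀ i, ∀ P ∈ Ω i, c P = n i)
    (h0 : ∀ᵐ P ∂μ, P ∉ ⋃ i, Ω i → c P = 0) (hfin : ∫⁻ P, c P ∂μ ≠ ⊤) :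
    HasSum (fun i => (n i : ℝ) * (μ (Ω i)).toReal) (∫⁻ P, c P ∂μ).toReal := by
  have hsum : ∫⁻ P, c P ∂μ = ∑' i, n i * μ (Ω i) := by
    calc ∫⁻ P, c P ∂μ = ∫⁻ P, (⋃ i, Ω i).indicator c P ∂μ := by
          refine lintegral_congr_ae ?_
          filter_upwards [h0] with P hP
          by_cases hPΩ : P ∈ ⋃ i, Ω i
          · rw [indicator_of_mem hPΩ]
          · rw [indicator_of_notMem hPΩ, hP hPΩ]
      _ = ∫⁻ P in ⋃ i, Ω i, c P ∂μ := lintegral_indicator (MeasurableSet.iUnion hm) c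
      _ = ∑' i, ∫⁻ P in Ω i, c P ∂μ := lintegral_iUnion hm hd _
      _ = ∑' i, n i * μ (Ω i) := tsum_congr fun i => by
          rw [setLIntegral_congr_fun (hm i) (hc i), setLIntegral_const]
  rw [hsum] at hfin ⊢
  rw [ENNReal.tsum_toReal_eq fun i => ENNReal.ne_top_of_tsum_ne_top hfin i]
  simpa using ENNReal.hasSum_toReal hfin

lemma hasSum_mul_measure_of_layers {E ι : Type*} [MeasurableSpace E] [Countable ι] {μ : Measure E}
    {F : ℂ → E} {Ω : ι → Set E} {n : ι → ℤ} (hm : ∀ i, MeasurableSet (Ω i))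
    (hd : Pairwise (Function.onFun Disjoint Ω))
    (hn : ∀ i, ∀ P ∈ Ω i, (layers F P).Finite ∧ ((layers F P).ncard : ℤ) = n i)
    (h0 : ∀ᵐ P ∂μ, P ∉ ⋃ i, Ω i → layers F P = ∅)
    (hfin : ∫⁻ P, Measure.count (layers F P) ∂μ ≠ ⊤) :
    HasSum (fun i => (n i : ℝ) * (μ (Ω i)).toReal)
      (∫⁻ P, Measure.count (layers F P) ∂μ).toReal := by
  have hcount : ∀ i, ∀ P ∈ Ω i, Measure.count (layers F P) = (n i).toNat := fun i P hP => by
    rw [count_layers (hn i P hP).1, ← (hn i P hP).2, Int.toNat_natCast]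
  convert hasSum_mul_measure hm hd hcount
    (h0.mono fun P hP hPΩ => by rw [hP hPΩ, measure_empty]) hfin using 2 with i
  rcases (Ω i).eq_empty_or_nonempty with hempty | ⟨P, hP⟩
  · simp [hempty]
  · rw [← (hn i P hP).2]
    simp

lemma pairwise_disjoint_complementComponents {E : Type*} [TopologicalSpace E] (X K : Set E) :
    Pairwise (Function.onFun Disjoint fun Ω : complementComponents X K => Ω.1) := by
  rintro ⟨_, P, hP, rfl⟩ ⟨_, Q, hQ, rfl⟩ hne
  refine Set.disjoint_left.2 fun R hRP hRQ => hne (Subtype.ext ?_)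
  exact (connectedComponentIn_eq hRP).trans (connectedComponentIn_eq hRQ).symm

lemma nonempty_of_mem_complementComponents {E : Type*} [TopologicalSpace E] {X K Ω : Set E}
    (h : Ω ∈ complementComponents X K) : Ω.Nonempty := by
  obtain ⟨P, hP, rfl⟩ := h
  exact ⟨P, mem_connectedComponentIn hP⟩

lemma subset_of_mem_complementComponents {E : Type*} [TopologicalSpace E] {X K Ω : Set E}
    (h : Ω ∈ complementComponents X K) : Ω ⊆ X \ K := by
  obtain ⟨P, -, rfl⟩ := h
  exact connectedComponentIn_subset _ _

lemma isPreconnected_of_mem_complementComponents {E : Type*} [TopologicalSpace E] {X K Ω : Set E}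
    (h : Ω ∈ complementComponents X K) : IsPreconnected Ω := by
  obtain ⟨P, -, rfl⟩ := h
  exact isPreconnected_connectedComponentIn

lemma layers_eq_empty_of_notMem {E : Type*} {F : ℂ → E} {P : E} (hP : P ∉ F '' closedBall 0 1) :
    layers F P = ∅ :=
  eq_empty_of_forall_notMem fun z hz => hP ⟨z, ball_subset_closedBall hz.1, hz.2⟩

lemma exists_exp_mul_I_eq {z : ℂ} (hz : z ∈ sphere (0 : ℂ) 1) :
    ∃ θ : ℝ, Complex.exp (θ * Complex.I) = z :=
  Complex.norm_eq_one_iff z |>.1 (mem_sphere_zero_iff_norm.1 hz)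

lemma Bounds.ne_of_mem_sphere {E : Type*} {γ : ℝ → E} {F : ℂ → E} (h : Bounds γ F) {P : E}
    (hP : P ∉ range γ) {z : ℂ} (hz : z ∈ sphere (0 : ℂ) 1) : F z ≠ P := by
  obtain ⟨φ, -, -, -, h⟩ := h
  obtain ⟨θ, rfl⟩ := exists_exp_mul_I_eq hz
  rw [h]
  exact fun hγP => hP ⟨_, hγP⟩

lemma exists_injOn_of_det_ne_zero {E : Type*} [NormedAddCommGroup E] [NormedSpace ℝ E]
    [FiniteDimensional ℝ E] {F : E → E} {z : E} (hF : ContDiffAt ℝ 1 F z)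
    (h : (fderiv ℝ F z).det ≠ 0) : ∃ V ∈ 𝓝 z, InjOn F V := by
  have hstrict := hF.hasStrictFDerivAt one_ne_zero
  rw [← ContinuousLinearMap.coe_toContinuousLinearEquivOfDetNeZero _ h] at hstrict
  have := FiniteDimensional.complete ℝ E
  exact ⟨_, (hstrict.toOpenPartialHomeomorph F).open_source.mem_nhds
    hstrict.mem_toOpenPartialHomeomorph_source, (hstrict.toOpenPartialHomeomorph F).injOn⟩

/-! ### Distorted disks in the plane -/

namespace PlaneGeometry

variable {G : PlaneGeometry} {γ : ℝ → ℂ} {F : ℂ → ℂ}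

lemma measurable_factor (G : PlaneGeometry) : Measurable G.factor := by
  cases G
  · exact measurable_const
  · change Measurable fun w : ℂ => 4 / (1 - ‖w‖ ^ 2) ^ 2
    fun_prop

lemma factor_nonneg (G : PlaneGeometry) (w : ℂ) : 0 ≤ G.factor w := by
  cases G
  · exact zero_le_one
  · change 0 ≤ 4 / (1 - ‖w‖ ^ 2) ^ 2
    positivity

lemma continuousOn_factor (G : PlaneGeometry) : ContinuousOn G.factor G.domain := by
  cases G
  · exact continuousOn_const
  · change ContinuousOn (fun w : ℂ => 4 / (1 - ‖w‖ ^ 2) ^ 2) (ball 0 1)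
    refine ContinuousOn.div (by fun_prop) (by fun_prop) fun w hw => pow_ne_zero 2 (ne_of_gt ?_)
    nlinarith [norm_nonneg w, mem_ball_zero_iff.1 hw]

/-- The area as a measure; it agrees with `setArea` on measurable sets. -/
noncomputable def areaMeasure (G : PlaneGeometry) : Measure ℂ :=
  volume.withDensity fun w => ENNReal.ofReal (G.factor w)

lemma areaMeasure_apply (G : PlaneGeometry) {Ω : Set ℂ} (h : MeasurableSet Ω) :
    G.areaMeasure Ω = G.setArea Ω :=
  withDensity_apply _ h

lemma ae_areaMeasure_notMem_range (G : PlaneGeometry) (hγ : IsClosedCurve γ) :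
    ∀ᵐ P ∂G.areaMeasure, P ∉ range γ :=
  (withDensity_absolutelyContinuous _ _).ae_le (measure_eq_zero_iff_ae_notMem.1 hγ.volume_range)

namespace IsDistortedDisk

lemma hasFDerivAt (hF : G.IsDistortedDisk F) {z : ℂ} (hz : z ∈ ball (0 : ℂ) 1) :
    HasFDerivAt F (fderiv ℝ F z) z :=
  ((hF.contDiffOn.contDiffAt (isOpen_ball.mem_nhds hz)).differentiableAt one_ne_zero).hasFDerivAt

lemma layers_hasDegree (hF : G.IsDistortedDisk F) {P : ℂ}
    (hP : ∀ z ∈ sphere (0 : ℂ) 1, F z ≠ P) : (layers F P).Finite ∧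
      HasDegree (fun θ => F (Complex.exp (θ * Complex.I)) - P) (layers F P).ncard := by
  have hcont : ContinuousOn (fun z => F z - P) (closedBall 0 1) :=
    hF.continuousOn.sub continuousOn_const
  have hsphere : ∀ z ∈ sphere (0 : ℂ) 1, F z - P ≠ 0 := fun z hz => sub_ne_zero.2 (hP z hz)
  have hsimple : ∀ z ∈ ball (0 : ℂ) 1, F z - P = 0 → IsSimpleZero (fun z => F z - P) z :=
    fun z hz h0 => .of_hasFDerivAt ((hF.hasFDerivAt hz).sub_const P) h0 (hF.det_pos z hz)
  have hzeros : {z ∈ ball (0 : ℂ) 1 | F z - P = 0} = layers F P := by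
    simp only [layers, sub_eq_zero]
  rw [← hzeros]
  exact ⟨finite_zeros hcont hsphere hsimple, hasDegree_ncard_zeros hcont hsphere hsimple⟩

lemma ncard_layers (hF : G.IsDistortedDisk F) (hγF : Bounds γ F) {P : ℂ} (hP : P ∉ range γ)
    {n : ℤ} (hn : HasDegree (fun θ => γ θ - P) n) :
    (layers F P).Finite ∧ ((layers F P).ncard : ℤ) = n := by
  obtain ⟨hfin, hdeg⟩ := hF.layers_hasDegree fun z => hγF.ne_of_mem_sphere hP
  obtain ⟨φ, hφ, -, hφ', h⟩ := hγF
  simp only [h] at hdeg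
  exact ⟨hfin, hdeg.unique (hn.comp hφ hφ')⟩

lemma area_eq_lintegral_count (hF : G.IsDistortedDisk F) :
    G.area F = ∫⁻ P, Measure.count (layers F P) ∂G.areaMeasure := by
  have hcont : ContinuousOn F (ball 0 1) := hF.continuousOn.mono ball_subset_closedBall
  refine lintegral_eq_lintegral_count isOpen_ball hcont
    (fun z hz => exists_injOn_of_det_ne_zero (hF.contDiffOn.contDiffAt (isOpen_ball.mem_nhds hz))
      (hF.det_pos z hz).ne') fun A hA hAm hAF => ?_
  rw [areaMeasure_apply G (hAm.image_of_continuousOn_injOn (hcont.mono hA) hAF), setArea,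
    lintegral_image_eq_lintegral_abs_det_fderiv_mul volume hAm
      (fun z hz => (hF.hasFDerivAt (hA hz)).hasFDerivWithinAt) hAF]
  refine setLIntegral_congr_fun hAm fun z _ => ?_
  rw [← ENNReal.ofReal_mul (abs_nonneg _), mul_comm, ← abs_of_nonneg (G.factor_nonneg (F z)),
    ← abs_mul, ← Real.sqrt_sq_eq_abs, det_eq_re_mul_im_sub]
  simp only [pullbackMetric, Complex.inner, Complex.mul_re, Complex.conj_re, Complex.conj_im]
  ring_nf

/-- Off the curve the number of layers is the winding number, and it vanishes off a compact subset
of the domain, so that the area is finite because the winding number is locally integrable. -/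
lemma area_ne_top (hγ : IsClosedCurve γ) (hF : G.IsDistortedDisk F) (hγF : Bounds γ F) :
    G.area F ≠ ⊤ := by
  have hK := (isCompact_closedBall (0 : ℂ) 1).image_of_continuousOn hF.continuousOn
  obtain ⟨R, hR⟩ := hK.isBounded.subset_ball (0 : ℂ)
  obtain ⟨C, hC⟩ := hK.exists_bound_of_continuousOn
    (G.continuousOn_factor.mono hF.mapsTo.image_subset)
  have hbound : ∀ᵐ P ∂volume, ENNReal.ofReal (G.factor P) * Measure.count (layers F P) ≤
      (ball 0 R).indicator (fun P => ENNReal.ofReal C * ‖windingNumber γ P‖ₑ) P := by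
    filter_upwards [measure_eq_zero_iff_ae_notMem.1 hγ.volume_range] with P hP
    by_cases hPF : P ∈ F '' closedBall 0 1
    · obtain ⟨n, hn⟩ := hγ.exists_hasDegree_sub hP
      obtain ⟨hfin, hcard⟩ := hF.ncard_layers hγF hP hn
      rw [indicator_of_mem (hR hPF), hγ.windingNumber_eq hn, ← hcard, count_layers hfin]
      refine mul_le_mul' (ENNReal.ofReal_le_ofReal ((le_abs_self _).trans (hC P hPF))) ?_
      rw [← ofReal_norm]
      simp
    · simp [layers_eq_empty_of_notMem hPF]
  rw [hF.area_eq_lintegral_count, areaMeasure]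
  refine ne_top_of_le_ne_top ?_ ((lintegral_withDensity_le_lintegral_mul _
    G.measurable_factor.ennreal_ofReal _).trans (lintegral_mono_ae hbound))
  rw [lintegral_indicator measurableSet_ball, lintegral_const_mul' _ _ ENNReal.ofReal_ne_top]
  exact ENNReal.mul_ne_top ENNReal.ofReal_ne_top
    (hγ.integrableOn_windingNumber R).hasFiniteIntegral.ne

lemma layers_eq_empty_of_not_isBounded (hF : G.IsDistortedDisk F) {n : ℤ} {Ω : Set ℂ}
    (hΩ : ¬ Bornology.IsBounded Ω)
    (hn : ∀ P ∈ Ω, (layers F P).Finite ∧ ((layers F P).ncard : ℤ) = n) {P : ℂ} (hP : P ∈ Ω) :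
    layers F P = ∅ := by
  have hK := (isCompact_closedBall (0 : ℂ) 1).image_of_continuousOn hF.continuousOn
  obtain ⟨Q, hQ, hQF⟩ := not_subset.1 fun h => hΩ (hK.isBounded.subset h)
  have hcard : (layers F P).ncard = (layers F Q).ncard := by
    exact_mod_cast (hn P hP).2.trans (hn Q hQ).2.symm
  rwa [layers_eq_empty_of_notMem hQF, ncard_empty, ncard_eq_zero (hn P hP).1] at hcard

lemma hasSum_area (hγ : IsClosedCurve γ) (hF : G.IsDistortedDisk F) (hγF : Bounds γ F)
    {ν : Set ℂ → ℤ} (hν : ∀ Ω ∈ complementComponents univ (range γ), ∀ P ∈ Ω,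
      (layers F P).Finite ∧ ((layers F P).ncard : ℤ) = ν Ω) :
    HasSum (fun Ω : {Ω : Set ℂ //
        Ω ∈ complementComponents univ (range γ) ∧ Bornology.IsBounded Ω} =>
      (ν Ω.1 : ℝ) * (G.setArea Ω.1).toReal) (G.area F).toReal := by
  have hopen : ∀ Ω ∈ complementComponents univ (range γ), IsOpen Ω := by
    rintro _ ⟨P, -, rfl⟩
    exact (isOpen_univ.sdiff hγ.isCompact_range.isClosed).connectedComponentIn
  have hd : Pairwise (Function.onFun Disjoint fun Ω : {Ω : Set ℂ //
      Ω ∈ complementComponents univ (range γ) ∧ Bornology.IsBounded Ω} => Ω.1) :=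
    fun Ω₁ Ω₂ hne => pairwise_disjoint_complementComponents univ (range γ)
      (i := ⟨Ω₁.1, Ω₁.2.1⟩) (j := ⟨Ω₂.1, Ω₂.2.1⟩) fun h => hne (Subtype.ext (congrArg (·.1) h))
  have hcount := hd.countable_of_isOpen_disjoint (fun Ω => hopen Ω.1 Ω.2.1)
    fun Ω => nonempty_of_mem_complementComponents Ω.2.1
  have hm : ∀ Ω ∈ complementComponents univ (range γ), G.areaMeasure Ω = G.setArea Ω :=
    fun Ω hΩ => G.areaMeasure_apply (hopen Ω hΩ).measurableSet
  have hempty : ∀ᵐ P ∂G.areaMeasure, P ∉ ⋃ Ω : {Ω : Set ℂ //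
      Ω ∈ complementComponents univ (range γ) ∧ Bornology.IsBounded Ω}, Ω.1 →
      layers F P = ∅ := by
    filter_upwards [G.ae_areaMeasure_notMem_range hγ] with P hP hPΩ
    have hPm : P ∈ univ \ range γ := ⟨mem_univ P, hP⟩
    have hPc := mem_connectedComponentIn hPm
    exact hF.layers_eq_empty_of_not_isBounded
      (fun hb => hPΩ (mem_iUnion.2 ⟨⟨_, ⟨P, hPm, rfl⟩, hb⟩, hPc⟩)) (hν _ ⟨P, hPm, rfl⟩) hPc
  have hfin := hF.area_ne_top hγ hγF
  rw [hF.area_eq_lintegral_count] at hfin ⊢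
  convert hasSum_mul_measure_of_layers (fun Ω => (hopen Ω.1 Ω.2.1).measurableSet) hd
    (fun Ω => hν Ω.1 Ω.2.1) hempty hfin using 3 with Ω
  rw [hm Ω.1 Ω.2.1]

end IsDistortedDisk

theorem area_eq_sum (G : PlaneGeometry) (hγ : IsClosedCurve γ) :
    ∃ ν : Set ℂ → ℤ,
      (∀ Ω ∈ complementComponents univ (range γ), ∀ P ∈ Ω, windingNumber γ P = ν Ω) ∧
      ∀ F : ℂ → ℂ, G.IsDistortedDisk F → Bounds γ F →
        (∀ Ω ∈ complementComponents univ (range γ), ∀ P ∈ Ω,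
          (layers F P).Finite ∧ ((layers F P).ncard : ℤ) = ν Ω) ∧
        G.area F ≠ ⊤ ∧
        HasSum (fun Ω : {Ω : Set ℂ //
            Ω ∈ complementComponents univ (range γ) ∧ Bornology.IsBounded Ω} =>
          (ν Ω.1 : ℝ) * (G.setArea Ω.1).toReal) (G.area F).toReal := by
  choose! ν hν using fun Ω (hΩ : Ω ∈ complementComponents univ (range γ)) =>
    hγ.exists_forall_hasDegree_sub hΩ
  refine ⟨ν, fun Ω hΩ P hP => hγ.windingNumber_eq (hν Ω hΩ P hP), fun F hF hγF => ?_⟩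
  have hlayers : ∀ Ω ∈ complementComponents univ (range γ), ∀ P ∈ Ω,
      (layers F P).Finite ∧ ((layers F P).ncard : ℤ) = ν Ω := fun Ω hΩ P hP =>
    hF.ncard_layers hγF (subset_of_mem_complementComponents hΩ hP).2 (hν Ω hΩ P hP)
  exact ⟨hlayers, hF.area_ne_top hγ hγF, hF.hasSum_area hγ hγF hlayers⟩

end PlaneGeometry

/-! ### Spinors -/

namespace Sphere

lemma mem_domain_iff {v : Space} : v ∈ domain ↔ v 0 ^ 2 + v 1 ^ 2 + v 2 ^ 2 = 1 := by
  rw [domain, mem_sphere_zero_iff_norm, ← pow_eq_one_iff_of_nonneg (norm_nonneg v) two_ne_zero,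
    EuclideanSpace.real_norm_sq_eq, Fin.sum_univ_three]

lemma ofReal_sum_sq_eq_one {v : Space} (hv : v ∈ domain) :
    (v 0 : ℂ) ^ 2 + (v 1 : ℂ) ^ 2 + (v 2 : ℂ) ^ 2 = 1 := by
  simpa using congrArg Complex.ofReal (mem_domain_iff.1 hv)

lemma dist_neg_self {v : Space} (hv : v ∈ domain) : dist (-v) v = 2 := by
  rw [dist_eq_norm, ← neg_add', norm_neg, ← two_smul ℝ, norm_smul, mem_sphere_zero_iff_norm.1 hv]
  norm_num

lemma ne_neg_self {v : Space} (hv : v ∈ domain) : v ≠ -v := fun h => by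
  have hdist := dist_neg_self hv
  rw [← h, dist_self] at hdist
  norm_num at hdist

/-- The area form of `ℂ²`. Two nonzero vectors span the same line if and only if it vanishes. -/
def wedge (p q : ℂ × ℂ) : ℂ := p.1 * q.2 - p.2 * q.1

/-- The standard Hermitian form of `ℂ²`. -/
def herm (p q : ℂ × ℂ) : ℂ := starRingEnd ℂ p.1 * q.1 + starRingEnd ℂ p.2 * q.2

/-- The factor by which `q` is a multiple of `p`, if `p ≠ 0` and `q` is on the line of `p`. -/
noncomputable def ratio (p q : ℂ × ℂ) : ℂ := herm p q / herm p p

/-- Twice the orthogonal projection of `ℂ²` to the complex line which represents `v`; this is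
`1 + v₀ σ₀ + v₁ σ₁ + v₂ σ₂` with the Pauli matrices `σᵢ`. -/
def proj (v : Space) (p : ℂ × ℂ) : ℂ × ℂ :=
  ((1 + v 2) * p.1 + (v 0 - v 1 * Complex.I) * p.2,
    (v 0 + v 1 * Complex.I) * p.1 + (1 - v 2) * p.2)

/-- `p` is a nonzero vector on the complex line in `ℂ²` which represents the point `v` of the
sphere; this is the line of slope `coord v`. -/
structure IsLift (v : Space) (p : ℂ × ℂ) : Prop where
  ne_zero : p ≠ 0
  proj_self : proj v p = (2 : ℂ) • p

lemma contDiff_wedge : ContDiff ℝ 1 fun q : (ℂ × ℂ) × (ℂ × ℂ) => wedge q.1 q.2 := by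
  unfold wedge
  fun_prop

lemma contDiff_proj : ContDiff ℝ 1 fun q : Space × (ℂ × ℂ) => proj q.1 q.2 := by
  have hcoord : ∀ i, ContDiff ℝ 1 fun q : Space × (ℂ × ℂ) => (q.1 i : ℂ) := fun i =>
    (Complex.ofRealCLM.comp (EuclideanSpace.proj i : Space →L[ℝ] ℝ)).contDiff.comp contDiff_fst
  have := hcoord 0
  have := hcoord 1
  have := hcoord 2
  unfold proj
  fun_prop

lemma continuousOn_proj {X : Type*} [TopologicalSpace X] {F : X → Space} {Φ : X → ℂ × ℂ}
    {s : Set X} (hF : ContinuousOn F s) (hΦ : ContinuousOn Φ s) :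
    ContinuousOn (fun x => proj (F x) (Φ x)) s := by
  unfold proj
  fun_prop

lemma wedge_self (p : ℂ × ℂ) : wedge p p = 0 := by
  rw [wedge]
  ring

lemma wedge_smul_left (a : ℂ) (p q : ℂ × ℂ) : wedge (a • p) q = a * wedge p q := by
  simp only [wedge, Prod.smul_fst, Prod.smul_snd, smul_eq_mul]
  ring

lemma wedge_smul_right (a : ℂ) (p q : ℂ × ℂ) : wedge p (a • q) = a * wedge p q := by
  simp only [wedge, Prod.smul_fst, Prod.smul_snd, smul_eq_mul]
  ring

lemma herm_self (p : ℂ × ℂ) :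
    herm p p = ((Complex.normSq p.1 + Complex.normSq p.2 : ℝ) : ℂ) := by
  rw [herm, Complex.ofReal_add, Complex.normSq_eq_conj_mul_self, Complex.normSq_eq_conj_mul_self]

lemma normSq_add_normSq_pos {p : ℂ × ℂ} (hp : p ≠ 0) :
    0 < Complex.normSq p.1 + Complex.normSq p.2 := by
  rcases not_and_or.1 (mt Prod.ext_iff.2 hp) with h | h
  · exact add_pos_of_pos_of_nonneg (Complex.normSq_pos.2 h) (Complex.normSq_nonneg _)
  · exact add_pos_of_nonneg_of_pos (Complex.normSq_nonneg _) (Complex.normSq_pos.2 h)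

lemma herm_self_ne_zero {p : ℂ × ℂ} (hp : p ≠ 0) : herm p p ≠ 0 := by
  rw [herm_self]
  exact Complex.ofReal_ne_zero.2 (normSq_add_normSq_pos hp).ne'

lemma ratio_smul {p q : ℂ × ℂ} (hp : p ≠ 0) (h : wedge p q = 0) : ratio p q • p = q := by
  have hpp := herm_self_ne_zero hp
  rw [wedge] at h
  apply Prod.ext
  · rw [Prod.smul_fst, smul_eq_mul, ratio, div_mul_eq_mul_div, div_eq_iff hpp, herm, herm]
    linear_combination starRingEnd ℂ p.2 * h
  · rw [Prod.smul_snd, smul_eq_mul, ratio, div_mul_eq_mul_div, div_eq_iff hpp, herm, herm]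
    linear_combination (-starRingEnd ℂ p.1) * h

lemma ratio_ne_zero {p q : ℂ × ℂ} (hp : p ≠ 0) (hq : q ≠ 0) (h : wedge p q = 0) :
    ratio p q ≠ 0 := fun h₀ => hq (by rw [← ratio_smul hp h, h₀, zero_smul])

lemma continuousAt_ratio {X : Type*} [TopologicalSpace X] {Γ₁ Γ₂ : X → ℂ × ℂ} {x : X}
    (h₁ : ContinuousAt Γ₁ x) (h₂ : ContinuousAt Γ₂ x) (h : Γ₁ x ≠ 0) :
    ContinuousAt (fun x => ratio (Γ₁ x) (Γ₂ x)) x := by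
  have hherm : Continuous fun q : (ℂ × ℂ) × (ℂ × ℂ) => herm q.1 q.2 := by
    have := Complex.continuous_conj
    unfold herm
    fun_prop
  exact (hherm.continuousAt.comp (h₁.prodMk h₂)).div (hherm.continuousAt.comp (h₁.prodMk h₁))
    (herm_self_ne_zero h)

namespace IsLift

variable {u v : Space} {p q : ℂ × ℂ}

lemma snd_eq (hp : IsLift v p) : (v 0 + v 1 * Complex.I) * p.1 = (1 + v 2) * p.2 := by
  have h := congrArg Prod.snd hp.proj_self
  simp only [Sphere.proj, Prod.smul_snd, smul_eq_mul] at h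
  linear_combination h

lemma fst_eq (hp : IsLift v p) : (v 0 - v 1 * Complex.I) * p.2 = (1 - v 2) * p.1 := by
  have h := congrArg Prod.fst hp.proj_self
  simp only [Sphere.proj, Prod.smul_fst, smul_eq_mul] at h
  linear_combination h

lemma of_eq (hp : p ≠ 0) (h₂ : (v 0 + v 1 * Complex.I) * p.1 = (1 + v 2) * p.2)
    (h₁ : (v 0 - v 1 * Complex.I) * p.2 = (1 - v 2) * p.1) : IsLift v p := by
  refine ⟨hp, Prod.ext ?_ ?_⟩
  · simp only [Sphere.proj, Prod.smul_fst, smul_eq_mul]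
    linear_combination h₁
  · simp only [Sphere.proj, Prod.smul_snd, smul_eq_mul]
    linear_combination h₂

lemma wedge_eq_zero (hp : IsLift v p) (hq : IsLift v q) : wedge p q = 0 := by
  refine (mul_eq_zero.1 ?_).resolve_left (two_ne_zero (α := ℂ))
  rw [wedge]
  linear_combination q.1 * hp.snd_eq - p.1 * hq.snd_eq - q.2 * hp.fst_eq + p.2 * hq.fst_eq

/-- The Hopf map: a point of the sphere can be read off its lifts. -/
lemma mul_herm_self (hp : IsLift v p) :
    v 0 * herm p p = starRingEnd ℂ p.1 * p.2 + starRingEnd ℂ p.2 * p.1 ∧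
      v 1 * herm p p = Complex.I * (starRingEnd ℂ p.2 * p.1 - starRingEnd ℂ p.1 * p.2) ∧
      v 2 * herm p p = starRingEnd ℂ p.1 * p.1 - starRingEnd ℂ p.2 * p.2 := by
  have h₁ := hp.snd_eq
  have h₂ := hp.fst_eq
  have h₁' := congrArg (starRingEnd ℂ) h₁
  have h₂' := congrArg (starRingEnd ℂ) h₂
  simp only [map_mul, map_add, map_sub, map_one, Complex.conj_ofReal, Complex.conj_I] at h₁' h₂'
  simp only [herm]
  refine ⟨?_, ?_, ?_⟩
  · linear_combination (1 / 2) * starRingEnd ℂ p.1 * h₁ + (1 / 2) * starRingEnd ℂ p.2 * h₂ +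
      (1 / 2) * p.1 * h₁' + (1 / 2) * p.2 * h₂'
  · linear_combination (-Complex.I / 2) * starRingEnd ℂ p.1 * h₁ +
      (Complex.I / 2) * starRingEnd ℂ p.2 * h₂ +
      (Complex.I / 2) * p.1 * h₁' - (Complex.I / 2) * p.2 * h₂' +
      (v 1 * (starRingEnd ℂ p.1 * p.1 + starRingEnd ℂ p.2 * p.2)) * Complex.I_mul_I
  · linear_combination starRingEnd ℂ p.1 * h₂ - p.2 * h₁'

lemma unique (hu : IsLift u p) (hv : IsLift v p) : u = v := by
  have hpp := herm_self_ne_zero hu.ne_zero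
  obtain ⟨hu₀, hu₁, hu₂⟩ := hu.mul_herm_self
  obtain ⟨hv₀, hv₁, hv₂⟩ := hv.mul_herm_self
  ext i
  fin_cases i
  · exact_mod_cast mul_right_cancel₀ hpp (hu₀.trans hv₀.symm)
  · exact_mod_cast mul_right_cancel₀ hpp (hu₁.trans hv₁.symm)
  · exact_mod_cast mul_right_cancel₀ hpp (hu₂.trans hv₂.symm)

lemma of_smul {k : ℂ} (hk : k ≠ 0) (h : IsLift v (k • p)) : IsLift v p := by
  have h₂ := h.snd_eq
  have h₁ := h.fst_eq
  simp only [Prod.smul_fst, Prod.smul_snd, smul_eq_mul] at h₁ h₂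
  refine of_eq (fun hp => h.ne_zero (by rw [hp, smul_zero])) (mul_left_cancel₀ hk ?_)
    (mul_left_cancel₀ hk ?_)
  · linear_combination h₂
  · linear_combination h₁

lemma wedge_eq_zero_iff (hp : IsLift u p) (hq : IsLift v q) : wedge p q = 0 ↔ u = v := by
  refine ⟨fun h => hp.unique (of_smul (ratio_ne_zero hp.ne_zero hq.ne_zero h) ?_),
    fun h => hp.wedge_eq_zero (h ▸ hq)⟩
  rwa [ratio_smul hp.ne_zero h]

lemma of_proj_ne_zero (hv : v ∈ domain) (h : proj v p ≠ 0) : IsLift v (proj v p) := by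
  have hsum := ofReal_sum_sq_eq_one hv
  refine of_eq h ?_ ?_
  · simp only [proj]
    linear_combination p.2 * hsum - p.2 * v 1 ^ 2 * Complex.I_mul_I
  · simp only [proj]
    linear_combination p.1 * hsum - p.1 * v 1 ^ 2 * Complex.I_mul_I

lemma proj (hp : IsLift u p) (hv : v ∈ domain) (huv : u ≠ -v) : IsLift v (proj v p) := by
  refine of_proj_ne_zero hv fun h => huv ?_
  have h₁ := congrArg Prod.fst h
  have h₂ := congrArg Prod.snd h
  simp only [Sphere.proj, Prod.fst_zero, Prod.snd_zero] at h₁ h₂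
  refine hp.unique (of_eq hp.ne_zero ?_ ?_)
  · simp only [PiLp.neg_apply, Complex.ofReal_neg]
    linear_combination -h₂
  · simp only [PiLp.neg_apply, Complex.ofReal_neg]
    linear_combination -h₁

end IsLift

lemma infinity_mem : infinity ∈ domain := by
  simp [mem_domain_iff, infinity]

lemma isLift_infinity : IsLift infinity (0, 1) := by
  refine .of_eq ?_ ?_ ?_ <;> simp [infinity]

lemma one_add_ne_zero {v : Space} (hv : v ∈ domain) (h : v ≠ infinity) : 1 + v 2 ≠ 0 := by
  intro h₀
  have hsum := mem_domain_iff.1 hv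
  have hv₂ : v 2 = -1 := by linarith
  rw [hv₂] at hsum
  have hv₀ : v 0 = 0 := by nlinarith [sq_nonneg (v 0), sq_nonneg (v 1)]
  have hv₁ : v 1 = 0 := by nlinarith [sq_nonneg (v 0), sq_nonneg (v 1)]
  refine h ?_
  ext i
  fin_cases i <;> simp [infinity, hv₀, hv₁, hv₂]

lemma isLift_coord {v : Space} (hv : v ∈ domain) (h : v ≠ infinity) : IsLift v (1, coord v) := by
  have hden : (1 + v 2 : ℂ) ≠ 0 := by
    simpa using Complex.ofReal_ne_zero.2 (one_add_ne_zero hv h)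
  have hsum := ofReal_sum_sq_eq_one hv
  refine .of_eq (by simp) ?_ ?_
  · simp only [coord]
    field_simp
  · simp only [coord]
    field_simp
    linear_combination hsum - v 1 ^ 2 * Complex.I_sq

lemma exists_isLift {v : Space} (hv : v ∈ domain) : ∃ p, IsLift v p := by
  by_cases h : v = infinity
  · exact ⟨_, h ▸ isLift_infinity⟩
  · exact ⟨_, isLift_coord hv h⟩

/-- `Φ` is a continuous lift of `F : X → S²` over `s`, with values in `ℂ² ∖ {0}`. -/
structure IsLiftOn {X : Type*} [TopologicalSpace X] (F : X → Space) (Φ : X → ℂ × ℂ)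
    (s : Set X) : Prop where
  continuousOn : ContinuousOn Φ s
  isLift : ∀ x ∈ s, IsLift (F x) (Φ x)

lemma IsLiftOn.proj {X : Type*} [TopologicalSpace X] {F G : X → Space} {Φ : X → ℂ × ℂ}
    {s : Set X} (h : IsLiftOn F Φ s) (hG : ContinuousOn G s) (hG' : MapsTo G s domain)
    (hFG : ∀ x ∈ s, F x ≠ -G x) : IsLiftOn G (fun x => Sphere.proj (G x) (Φ x)) s where
  continuousOn := continuousOn_proj hG h.continuousOn
  isLift x hx := (h.isLift x hx).proj (hG' hx) (hFG x hx)

lemma exists_isLiftOn_of_ne_neg {X : Type*} [TopologicalSpace X] {F : ℕ → X → Space} {s : Set X}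
    {n : ℕ} (hF : ∀ k ≤ n, ContinuousOn (F k) s) (hF' : ∀ k ≤ n, MapsTo (F k) s domain)
    (hne : ∀ k < n, ∀ x ∈ s, F k x ≠ -F (k + 1) x) (h0 : ∃ Φ, IsLiftOn (F 0) Φ s) :
    ∃ Φ, IsLiftOn (F n) Φ s := by
  induction n with
  | zero => exact h0
  | succ n ih =>
    obtain ⟨Φ, hΦ⟩ := ih (fun k hk => hF k (hk.trans n.le_succ))
      (fun k hk => hF' k (hk.trans n.le_succ)) fun k hk => hne k (hk.trans n.lt_succ_self)
    exact ⟨_, hΦ.proj (hF _ le_rfl) (hF' _ le_rfl) (hne n n.lt_succ_self)⟩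

/-- The lift is transported by projections along the contraction `x ↦ F (t • x)`, in steps so short
that no point is moved to its antipode. -/
theorem exists_isLiftOn_of_starConvex {E : Type*} [NormedAddCommGroup E] [NormedSpace ℝ E]
    {F : E → Space} {s : Set E} (hs : IsCompact s) (hstar : StarConvex ℝ 0 s) (h0 : (0 : E) ∈ s)
    (hF : ContinuousOn F s) (hF' : MapsTo F s domain) : ∃ Φ, IsLiftOn F Φ s := by
  obtain ⟨δ, hδ, hδF⟩ := Metric.uniformContinuousOn_iff.1
    (hs.uniformContinuousOn_of_continuous hF) 2 two_pos
  obtain ⟨R, hR, hsR⟩ := hs.isBounded.subset_closedBall_lt 0 0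
  obtain ⟨n, hn⟩ := exists_nat_one_div_lt (div_pos hδ hR)
  have hpos : (0 : ℝ) < n + 1 := n.cast_add_one_pos
  have hmem : ∀ k ≤ n + 1, MapsTo (fun x => (k / (n + 1) : ℝ) • x) s s := fun k hk x hx =>
    hstar.smul_mem hx (by positivity) ((div_le_one hpos).2 (by exact_mod_cast hk))
  have hstep : ∀ k : ℕ, ∀ x ∈ s,
      dist ((k / (n + 1) : ℝ) • x) (((k + 1 : ℕ) / (n + 1) : ℝ) • x) < δ := fun k x hx =>
    calc dist ((k / (n + 1) : ℝ) • x) (((k + 1 : ℕ) / (n + 1) : ℝ) • x) = 1 / (n + 1) * ‖x‖ := by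
          rw [dist_comm, dist_eq_norm, ← sub_smul, norm_smul, ← sub_div, Nat.cast_succ,
            add_sub_cancel_left, Real.norm_of_nonneg (by positivity)]
      _ ≤ 1 / (n + 1) * R := by
          gcongr
          exact mem_closedBall_zero_iff.1 (hsR hx)
      _ < δ := (lt_div_iff₀ hR).1 hn
  obtain ⟨p, hp⟩ := exists_isLift (hF' h0)
  have hne : ∀ k < n + 1, ∀ x ∈ s,
      F ((k / (n + 1) : ℝ) • x) ≠ -F (((k + 1 : ℕ) / (n + 1) : ℝ) • x) := fun k hk x hx hneg => by
    have hclose := hδF _ (hmem k hk.le hx) _ (hmem (k + 1) hk hx) (hstep k x hx)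
    rw [hneg, dist_neg_self (hF' (hmem (k + 1) hk hx))] at hclose
    exact lt_irrefl _ hclose
  have hone : ((n + 1 : ℕ) / (n + 1) : ℝ) = 1 := by
    rw [Nat.cast_succ, div_self hpos.ne']
  obtain ⟨Φ, hΦ⟩ := exists_isLiftOn_of_ne_neg (n := n + 1) (s := s)
    (F := fun k x => F ((k / (n + 1) : ℝ) • x))
    (fun k hk => hF.comp (by fun_prop) (hmem k hk)) (fun k hk => hF'.comp (hmem k hk))
    hne
    ⟨fun _ => p, continuousOn_const, fun x _ => by simpa using hp⟩
  exact ⟨Φ, by simpa only [hone, one_smul] using hΦ⟩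

/-- The linear form `v ↦ wedge p (proj v p)`, which identifies the tangent plane of the sphere at
the point represented by `p` with `ℂ`. -/
noncomputable def spinForm (p : ℂ × ℂ) : Space →L[ℝ] ℂ :=
  LinearMap.toContinuousLinearMap
    { toFun := fun v => (v 0 + v 1 * Complex.I) * p.1 ^ 2 - 2 * v 2 * p.1 * p.2
        - (v 0 - v 1 * Complex.I) * p.2 ^ 2
      map_add' := fun u v => by
        simp only [PiLp.add_apply, Complex.ofReal_add]
        ring
      map_smul' := fun c v => by
        simp only [PiLp.smul_apply, smul_eq_mul, Complex.ofReal_mul, RingHom.id_apply,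
          Complex.real_smul]
        ring }

lemma spinForm_apply (p : ℂ × ℂ) (v : Space) :
    spinForm p v = (v 0 + v 1 * Complex.I) * p.1 ^ 2 - 2 * v 2 * p.1 * p.2
        - (v 0 - v 1 * Complex.I) * p.2 ^ 2 := rfl

lemma wedge_proj (p : ℂ × ℂ) (v : Space) : wedge p (proj v p) = spinForm p v := by
  rw [spinForm_apply, wedge, proj]
  ring

/-- The determinant of the three vectors `u`, `v` and `w`, positive for a positively oriented
basis. -/
noncomputable def det₃ (u v w : Space) : ℝ := (Matrix.of fun i j : Fin 3 => (![u, v, w] i) j).det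

lemma det₃_eq (u v w : Space) : det₃ u v w = u 0 * v 1 * w 2 - u 0 * v 2 * w 1 - u 1 * v 0 * w 2 +
    u 1 * v 2 * w 0 + u 2 * v 0 * w 1 - u 2 * v 1 * w 0 := by
  rw [det₃, Matrix.det_fin_three]
  simp

lemma IsLift.spinForm_det₃ {v : Space} {p : ℂ × ℂ} (hp : IsLift v p) (a b : Space) :
    (spinForm p a).re * (spinForm p b).im - (spinForm p b).re * (spinForm p a).im =
      (Complex.normSq p.1 + Complex.normSq p.2) ^ 2 * det₃ v a b := by
  obtain ⟨h₀, h₁, h₂⟩ := hp.mul_herm_self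
  rw [herm_self, ← Complex.ofReal_mul] at h₀ h₁ h₂
  replace h₀ := congrArg Complex.re h₀
  replace h₁ := congrArg Complex.re h₁
  replace h₂ := congrArg Complex.re h₂
  rw [Complex.ofReal_re] at h₀ h₁ h₂
  set s := Complex.normSq p.1 + Complex.normSq p.2 with hs
  have hdet : s ^ 2 * det₃ v a b =
      s * (v 0 * s * (a 1 * b 2 - a 2 * b 1) - v 1 * s * (a 0 * b 2 - a 2 * b 0) +
        v 2 * s * (a 0 * b 1 - a 1 * b 0)) := by
    rw [det₃_eq]
    ring
  rw [hdet, h₀, h₁, h₂, hs, Complex.normSq_apply, Complex.normSq_apply]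
  simp [spinForm_apply, pow_two]
  ring

end Sphere

/-! ### Lifts of distorted disks -/

lemma IsNearMultiple.of_contDiffAt_of_diag_eq_zero {D : ℂ × ℂ → ℂ} {z₀ : ℂ}
    (hD : ContDiffAt ℝ 1 D (z₀, z₀)) (hdiag : ∀ z, D (z, z) = 0) {L : ℂ →L[ℝ] ℂ}
    (hL : HasFDerivAt (fun u => D (z₀, u)) L z₀) (hdet : 0 < L.det) :
    IsNearMultiple D (fun q => q.2 - q.1) (𝓝 (z₀, z₀)) := by
  have hstrict := hD.hasStrictFDerivAt one_ne_zero
  have hinr : (fderiv ℝ D (z₀, z₀)).comp (ContinuousLinearMap.inr ℝ ℂ ℂ) = L :=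
    (hstrict.hasFDerivAt.comp z₀ (hasFDerivAt_prodMk_right z₀ z₀)).unique hL
  have hlim : Filter.Tendsto (fun q : ℂ × ℂ => (q, (q.1, q.1))) (𝓝 (z₀, z₀))
      (𝓝 ((z₀, z₀), (z₀, z₀))) :=
    (by fun_prop : Continuous fun q : ℂ × ℂ => (q, (q.1, q.1))).tendsto (z₀, z₀)
  have hdiff : ∀ q : ℂ × ℂ, q - (q.1, q.1) = ContinuousLinearMap.inr ℝ ℂ ℂ (q.2 - q.1) :=
    fun q => by simp [Prod.ext_iff]
  refine .of_isLittleO hdet (((hstrict.isLittleO.comp_tendsto hlim).congr_left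
    fun q => ?_).trans_isBigO (.of_bound 1 (.of_forall fun q => ?_)))
  · simp only [Function.comp_apply, hdiag, sub_zero, hdiff, ← hinr,
      ContinuousLinearMap.comp_apply]
  · simp only [Function.comp_apply, hdiff, ContinuousLinearMap.inr_apply, Prod.norm_mk, norm_zero]
    simp

namespace Sphere

lemma contDiffAt_proj {F : ℂ → Space} {z₀ : ℂ} (hF : ContDiffAt ℝ 1 F z₀) (p : ℂ × ℂ) :
    ContDiffAt ℝ 1 (fun z => proj (F z) p) z₀ :=
  contDiff_proj.contDiffAt.comp z₀ (hF.prodMk contDiffAt_const)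

lemma isNearMultiple_wedge_proj {F : ℂ → Space} {z₀ : ℂ} (hF : ContDiffAt ℝ 1 F z₀)
    (hdet : 0 < det₃ (F z₀) (fderiv ℝ F z₀ 1) (fderiv ℝ F z₀ Complex.I))
    {p : ℂ × ℂ} (hp : IsLift (F z₀) p) :
    IsNearMultiple (fun q : ℂ × ℂ => wedge (proj (F q.1) p) (proj (F q.2) p))
      (fun q => q.2 - q.1) (𝓝 (z₀, z₀)) := by
  have hproj := contDiffAt_proj hF p
  refine .of_contDiffAt_of_diag_eq_zero (L := (2 : ℂ) • (spinForm p).comp (fderiv ℝ F z₀))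
    (contDiff_wedge.contDiffAt.comp (z₀, z₀)
      ((hproj.comp (z₀, z₀) (f := Prod.fst) contDiffAt_fst).prodMk
        (hproj.comp (z₀, z₀) (f := Prod.snd) contDiffAt_snd))) (fun z => wedge_self _) ?_ ?_
  · simp only [hp.proj_self, wedge_smul_left, wedge_proj]
    exact ((spinForm p).hasFDerivAt.comp z₀
      (hF.differentiableAt one_ne_zero).hasFDerivAt).const_mul 2
  · have hspin := hp.spinForm_det₃ (fderiv ℝ F z₀ 1) (fderiv ℝ F z₀ Complex.I)
    have hnorm := normSq_add_normSq_pos hp.ne_zero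
    have hscale : ((2 : ℂ) • (spinForm p).comp (fderiv ℝ F z₀)).det =
        4 * ((Complex.normSq p.1 + Complex.normSq p.2) ^ 2 *
          det₃ (F z₀) (fderiv ℝ F z₀ 1) (fderiv ℝ F z₀ Complex.I)) := by
      rw [← hspin, det_eq_re_mul_im_sub]
      simp
      ring
    rw [hscale]
    positivity

namespace IsDistortedDisk

variable {F : ℂ → Space} {Φ : ℂ → ℂ × ℂ}

lemma contDiffAt (hF : IsDistortedDisk F) {z : ℂ} (hz : z ∈ ball (0 : ℂ) 1) :
    ContDiffAt ℝ 1 F z := hF.contDiffOn.contDiffAt (isOpen_ball.mem_nhds hz)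

lemma exists_isLiftOn (hF : IsDistortedDisk F) : ∃ Φ, IsLiftOn F Φ (closedBall 0 1) :=
  exists_isLiftOn_of_starConvex (isCompact_closedBall 0 1)
    ((convex_closedBall 0 1).starConvex (mem_closedBall_self zero_le_one))
    (mem_closedBall_self zero_le_one) hF.continuousOn hF.mapsTo

/-- Near `z₀`, any lift differs from the differentiable lift `z ↦ proj (F z) (Φ z₀)` by a continuous
nonvanishing factor. -/
lemma isNearMultiple_wedge (hF : IsDistortedDisk F) (hΦ : IsLiftOn F Φ (closedBall 0 1)) {z₀ : ℂ}
    (hz₀ : z₀ ∈ ball (0 : ℂ) 1) :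
    IsNearMultiple (fun q : ℂ × ℂ => wedge (Φ q.1) (Φ q.2)) (fun q => q.2 - q.1)
      (𝓝 (z₀, z₀)) := by
  have hnhds : closedBall (0 : ℂ) 1 ∈ 𝓝 z₀ := closedBall_mem_nhds_of_mem hz₀
  have hp := hΦ.isLift z₀ (ball_subset_closedBall hz₀)
  have hFz₀ := hF.mapsTo (ball_subset_closedBall hz₀)
  have hFc : ContinuousAt F z₀ := (hF.contDiffAt hz₀).continuousAt
  set S : ℂ → ℂ × ℂ := fun z => proj (F z) (Φ z₀)
  set k : ℂ → ℂ := fun z => ratio (S z) (Φ z)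
  have hS : ∀ᶠ z in 𝓝 z₀, IsLift (F z) (S z) := by
    filter_upwards [hFc.neg.eventually_ne (ne_neg_self hFz₀).symm, hnhds] with z hz hz'
      using hp.proj (hF.mapsTo hz') hz.symm
  have hkS : ∀ᶠ z in 𝓝 z₀, Φ z = k z • S z := by
    filter_upwards [hS, hnhds] with z hz hz'
      using (ratio_smul hz.ne_zero (hz.wedge_eq_zero (hΦ.isLift z hz'))).symm
  have hkc : ContinuousAt k z₀ :=
    continuousAt_ratio (contDiffAt_proj (hF.contDiffAt hz₀) _).continuousAt
      (hΦ.continuousOn.continuousAt hnhds) hS.self_of_nhds.ne_zero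
  have hk₀ : k z₀ ≠ 0 := ratio_ne_zero hS.self_of_nhds.ne_zero hp.ne_zero
    (hS.self_of_nhds.wedge_eq_zero hp)
  have hkk : Filter.Tendsto (fun q : ℂ × ℂ => k q.1 * k q.2) (𝓝 (z₀, z₀)) (𝓝 (k z₀ * k z₀)) :=
    nhds_prod_eq (x := z₀) (y := z₀) ▸
      (hkc.tendsto.comp Filter.tendsto_fst).mul (hkc.tendsto.comp Filter.tendsto_snd)
  refine ((isNearMultiple_wedge_proj (hF.contDiffAt hz₀) (hF.det_pos z₀ hz₀) hp).mul hkk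
    (mul_ne_zero hk₀ hk₀)).congr ?_
  rw [nhds_prod_eq]
  filter_upwards [Filter.tendsto_fst.eventually hkS, Filter.tendsto_snd.eventually hkS]
    with q hq₁ hq₂
  rw [hq₁, hq₂, wedge_smul_left, wedge_smul_right, mul_assoc]

lemma exists_injOn (hF : IsDistortedDisk F) {z₀ : ℂ} (hz₀ : z₀ ∈ ball (0 : ℂ) 1) :
    ∃ U ∈ 𝓝 z₀, InjOn F (U ∩ closedBall 0 1) := by
  obtain ⟨Φ, hΦ⟩ := hF.exists_isLiftOn
  have hinj := (hF.isNearMultiple_wedge hΦ hz₀).eventually_eq_zero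
  rw [nhds_prod_eq] at hinj
  obtain ⟨U, hU, hUU⟩ := Filter.mem_prod_self_iff.1 hinj
  refine ⟨U, hU, fun x hx y hy hxy => (sub_eq_zero.1 (hUU (mk_mem_prod hx.1 hy.1) ?_)).symm⟩
  exact ((hΦ.isLift x hx.2).wedge_eq_zero_iff (hΦ.isLift y hy.2)).2 hxy

lemma exists_uniform_injOn (hF : IsDistortedDisk F) :
    ∃ δ > 0, ∀ x ∈ closedBall (0 : ℂ) 1, ∀ y ∈ closedBall (0 : ℂ) 1, dist x y < δ →
      F x = F y → x = y := by
  have hlocal : ∀ z ∈ closedBall (0 : ℂ) 1, ∃ U ∈ 𝓝 z, InjOn F (U ∩ closedBall 0 1) := by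
    intro z hz
    rw [← ball_union_sphere] at hz
    exact hz.elim hF.exists_injOn (hF.locally_injective z)
  choose! U hU hUF using hlocal
  obtain ⟨δ, hδ, hlebesgue⟩ := lebesgue_number_lemma_of_metric (isCompact_closedBall (0 : ℂ) 1)
    (c := fun z : closedBall (0 : ℂ) 1 => interior (U z)) (fun _ => isOpen_interior)
    fun z hz => mem_iUnion.2 ⟨⟨z, hz⟩, mem_interior_iff_mem_nhds.2 (hU z hz)⟩
  refine ⟨δ, hδ, fun x hx y hy hxy he => ?_⟩
  obtain ⟨z, hz⟩ := hlebesgue x hx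
  exact hUF z z.2 ⟨interior_subset (hz (mem_ball_self hδ)), hx⟩
    ⟨interior_subset (hz (mem_ball'.2 hxy)), hy⟩ he

lemma isSimpleZero_wedge (hF : IsDistortedDisk F) (hΦ : IsLiftOn F Φ (closedBall 0 1))
    {p : ℂ × ℂ} {z : ℂ} (hz : z ∈ ball (0 : ℂ) 1) (hp : IsLift (F z) p) :
    IsSimpleZero (fun u => wedge p (Φ u)) z := by
  have hlim : Filter.Tendsto (fun u : ℂ => (z, u)) (𝓝 z) (𝓝 (z, z)) :=
    (Continuous.prodMk_right z).tendsto z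
  have hzero : IsSimpleZero (fun u => wedge (Φ z) (Φ u)) z :=
    (hF.isNearMultiple_wedge hΦ hz).comp_tendsto (φ := fun u => (z, u)) hlim
  have hΦz := hΦ.isLift z (ball_subset_closedBall hz)
  have hpΦ := hΦz.wedge_eq_zero hp
  rw [← ratio_smul hΦz.ne_zero hpΦ]
  simp only [wedge_smul_left]
  exact hzero.mul continuousAt_const (ratio_ne_zero hΦz.ne_zero hp.ne_zero hpΦ)

lemma layers_hasDegree (hF : IsDistortedDisk F) (hΦ : IsLiftOn F Φ (closedBall 0 1)) {P : Space}
    {p : ℂ × ℂ} (hp : IsLift P p) (hP : ∀ z ∈ sphere (0 : ℂ) 1, F z ≠ P) :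
    (layers F P).Finite ∧ HasDegree (fun θ => wedge p (Φ (Complex.exp (θ * Complex.I))))
      (layers F P).ncard := by
  have hcont : ContinuousOn (fun z => wedge p (Φ z)) (closedBall 0 1) :=
    contDiff_wedge.continuous.comp_continuousOn (continuousOn_const.prodMk hΦ.continuousOn)
  have hiff : ∀ z ∈ closedBall (0 : ℂ) 1, wedge p (Φ z) = 0 ↔ F z = P := fun z hz => by
    rw [hp.wedge_eq_zero_iff (hΦ.isLift z hz), eq_comm]
  have hsphere : ∀ z ∈ sphere (0 : ℂ) 1, wedge p (Φ z) ≠ 0 := fun z hz h =>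
    hP z hz ((hiff z (sphere_subset_closedBall hz)).1 h)
  have hsimple : ∀ z ∈ ball (0 : ℂ) 1, wedge p (Φ z) = 0 →
      IsSimpleZero (fun z => wedge p (Φ z)) z :=
    fun z hz hz₀ => hF.isSimpleZero_wedge hΦ hz ((hiff z (ball_subset_closedBall hz)).1 hz₀ ▸ hp)
  have hzeros : {z ∈ ball (0 : ℂ) 1 | wedge p (Φ z) = 0} = layers F P :=
    ext fun z => and_congr_right fun hz => hiff z (ball_subset_closedBall hz)
  rw [← hzeros]
  exact ⟨finite_zeros hcont hsphere hsimple, hasDegree_ncard_zeros hcont hsphere hsimple⟩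

end IsDistortedDisk

end Sphere

/-! ### Reparametrizations of the circle -/

lemma exists_inverse_of_strictMono_of_add_two_pi {φ : ℝ → ℝ} (hφ : Continuous φ)
    (hm : StrictMono φ) (hp : ∀ θ, φ (θ + 2 * π) = φ θ + 2 * π) :
    ∃ ψ : ℝ → ℝ, Continuous ψ ∧ StrictMono ψ ∧ (∀ θ, ψ (θ + 2 * π) = ψ θ + 2 * π) ∧
      ∀ θ, φ (ψ θ) = θ := by
  have hperiodic : Function.Periodic (fun θ => φ θ - θ) (2 * π) := fun θ => by
    simp only [hp]
    ring
  have hmul : ∀ n : ℤ, φ (n * (2 * π)) = φ 0 + n * (2 * π) := fun n => by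
    have hn := hperiodic.int_mul_eq n
    simp only [sub_zero] at hn
    linarith
  have hsurj : Function.Surjective φ := by
    refine hφ.surjective
      (Filter.tendsto_atTop_atTop_of_monotone hm.monotone fun b => ?_)
      (Filter.tendsto_atBot_atBot_of_monotone hm.monotone fun b => ?_)
    · obtain ⟨n, hn⟩ := exists_int_gt ((b - φ 0) / (2 * π))
      rw [div_lt_iff₀ Real.two_pi_pos] at hn
      exact ⟨n * (2 * π), by rw [hmul]; linarith⟩
    · obtain ⟨n, hn⟩ := exists_int_lt ((b - φ 0) / (2 * π))
      rw [lt_div_iff₀ Real.two_pi_pos] at hn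
      exact ⟨n * (2 * π), by rw [hmul]; linarith⟩
  let e := hm.orderIsoOfSurjective φ hsurj
  have he : ∀ θ, φ (e.symm θ) = θ := e.apply_symm_apply
  exact ⟨e.symm, e.symm.continuous, e.symm.strictMono,
    fun θ => hm.injective (by rw [he, hp, he]), he⟩

lemma exp_sub_exp_eq_mul (a b : ℝ) :
    Complex.exp (b * Complex.I) - Complex.exp (a * Complex.I) =
      Complex.exp (a * Complex.I) * (Complex.exp (Complex.I * (b - a : ℝ)) - 1) := by
  rw [mul_sub, ← Complex.exp_add, mul_one]
  congr 2
  push_cast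
  ring

lemma norm_exp_sub_exp_le (a b : ℝ) :
    ‖Complex.exp (b * Complex.I) - Complex.exp (a * Complex.I)‖ ≤ |b - a| := by
  rw [exp_sub_exp_eq_mul, norm_mul, Complex.norm_exp_ofReal_mul_I, one_mul]
  exact Real.norm_exp_I_mul_ofReal_sub_one_le

lemma HasDegree.exp_sub_exp {ψ : ℝ → ℝ} (hψ : Continuous ψ)
    (hp : ∀ θ, ψ (θ + 2 * π) = ψ θ + 2 * π) {ε : ℝ} (h : ∀ θ, ψ (θ + ε) - ψ θ ∈ Ioo 0 π) :
    HasDegree (fun θ => Complex.exp (ψ (θ + ε) * Complex.I) - Complex.exp (ψ θ * Complex.I)) 1 := by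
  have hrel : HasDegree (fun θ => Complex.exp (Complex.I * (ψ (θ + ε) - ψ θ : ℝ)) - 1) 0 := by
    refine .of_mem_slitPlane (by fun_prop) (fun θ => ?_) fun θ => Or.inr ?_
    · simp only [hp, add_right_comm θ, add_sub_add_right_eq_sub]
    · rw [mul_comm, Complex.sub_im, Complex.exp_ofReal_mul_I_im, Complex.one_im, sub_zero]
      exact (Real.sin_pos_of_pos_of_lt_pi (h θ).1 (h θ).2).ne'
  simpa only [exp_sub_exp_eq_mul, add_zero] using (HasDegree.exp_mul_I.comp hψ hp).mul hrel

lemma eventually_sub_mem_Ioo {ψ : ℝ → ℝ} (hψ : Continuous ψ) (hm : StrictMono ψ)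
    (hp : ∀ θ, ψ (θ + 2 * π) = ψ θ + 2 * π) {δ : ℝ} (hδ : 0 < δ) :
    ∀ᶠ ε in 𝓝[>] (0 : ℝ), ∀ θ, ψ (θ + ε) - ψ θ ∈ Ioo 0 δ := by
  have hlt : ∀ᶠ ε in 𝓝 (0 : ℝ), ∀ θ ∈ Icc 0 (2 * π), ψ (θ + ε) - ψ θ < δ := by
    refine isCompact_Icc.eventually_forall_of_forall_eventually fun θ _ => ?_
    have hcont : Continuous fun q : ℝ × ℝ => ψ (q.2 + q.1) - ψ q.2 := by fun_prop
    exact (hcont.tendsto (0, θ)).eventually (gt_mem_nhds (by simpa using hδ))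
  filter_upwards [hlt.filter_mono nhdsWithin_le_nhds, self_mem_nhdsWithin] with ε hltε hε θ
  refine ⟨sub_pos.2 (hm (lt_add_of_pos_right θ hε)), ?_⟩
  refine forall_of_periodic_of_forall_mem_Icc (p := fun θ => ψ (θ + ε) - ψ θ < δ)
    Real.two_pi_pos (fun θ => ?_) hltε θ
  simp only [hp, add_right_comm θ, add_sub_add_right_eq_sub]

/-! ### The boundary of a lift -/

lemma IsNearMultiple.exists_hasDegree_mul {D : ℂ × ℂ → ℂ}
    (hD : IsNearMultiple D (fun q => q.2 - q.1) (𝓝 (0, 0))) :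
    ∃ r₀ > (0 : ℝ), ∀ r ∈ Ioo 0 r₀, ∀ (x y : ℝ → ℂ) (n : ℤ), (∀ θ, ‖x θ‖ = 1) → (∀ θ, ‖y θ‖ = 1) →
      Continuous (fun θ => D (r * x θ, r * y θ)) →
      Function.Periodic (fun θ => D (r * x θ, r * y θ)) (2 * π) →
      HasDegree (fun θ => y θ - x θ) n → HasDegree (fun θ => D (r * x θ, r * y θ)) n := by
  obtain ⟨a, ha, c, hc, hac⟩ := hD
  obtain ⟨r₀, hr₀, hball⟩ := Metric.mem_nhds_iff.1 hac
  refine ⟨r₀, hr₀, fun r hr x y n hx hy hcont hperiodic hn => ?_⟩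
  have hr' : (r : ℂ) ≠ 0 := Complex.ofReal_ne_zero.2 hr.1.ne'
  have hmodel : HasDegree (fun θ => a * (r * y θ - r * x θ)) n := by
    simpa only [zero_add, mul_sub, mul_assoc] using (HasDegree.const (mul_ne_zero ha hr')).mul hn
  refine hmodel.of_norm_sub_lt hcont hperiodic fun θ => ?_
  have hmem : ((r : ℂ) * x θ, (r : ℂ) * y θ) ∈ ball ((0 : ℂ), (0 : ℂ)) r₀ := by
    simp [Prod.dist_eq, hx, hy, abs_of_pos hr.1, hr.2]
  exact (hball hmem).trans_lt (mul_lt_of_lt_one_left (norm_pos_iff.2 (hmodel.ne_zero θ)) hc)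

namespace Sphere

lemma continuous_wedge {X : Type*} [TopologicalSpace X] {f g : X → ℂ × ℂ} (hf : Continuous f)
    (hg : Continuous g) : Continuous fun x => wedge (f x) (g x) := by
  unfold wedge
  fun_prop

/-- Shrink the pair of loops to the center of the disk, where the wedge is comparable to
`y - x`; it cannot vanish on the way, since `F` is injective at scale `δ` up to the boundary. -/
lemma IsDistortedDisk.exists_hasDegree_wedge {F : ℂ → Space} {Φ : ℂ → ℂ × ℂ}
    (hF : IsDistortedDisk F) (hΦ : IsLiftOn F Φ (closedBall 0 1)) :
    ∃ δ > 0, ∀ (x y : ℝ → ℂ) (n : ℤ), Continuous x → Continuous y →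
      Function.Periodic x (2 * π) → Function.Periodic y (2 * π) →
      (∀ θ, ‖x θ‖ = 1) → (∀ θ, ‖y θ‖ = 1) → (∀ θ, dist (x θ) (y θ) < δ) →
      HasDegree (fun θ => y θ - x θ) n → HasDegree (fun θ => wedge (Φ (x θ)) (Φ (y θ))) n := by
  obtain ⟨δ, hδ, hinj⟩ := hF.exists_uniform_injOn
  obtain ⟨r₀, hr₀, hcenter⟩ :=
    (hF.isNearMultiple_wedge hΦ (mem_ball_self one_pos)).exists_hasDegree_mul
  refine ⟨δ, hδ, fun x y n hxc hyc hxp hyp hx hy hdist hn => ?_⟩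
  have hmem : ∀ t ∈ Ioc (0 : ℝ) 1, ∀ z : ℂ, ‖z‖ = 1 → (t : ℂ) * z ∈ closedBall (0 : ℂ) 1 :=
    fun t ht z hz => by simpa [hz, abs_of_pos ht.1] using ht.2
  have hcont : ∀ z : ℝ → ℂ, Continuous z → (∀ θ, ‖z θ‖ = 1) →
      ContinuousOn (fun q : ℝ × ℝ => Φ (q.1 * z q.2)) (Ioc 0 1 ×ˢ univ) := fun z hzc hz =>
    hΦ.continuousOn.comp (by fun_prop) fun q hq => hmem _ hq.1 _ (hz _)
  have hH : ContinuousOn (Function.uncurry fun (t : ℝ) (θ : ℝ) =>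
      wedge (Φ (t * x θ)) (Φ (t * y θ))) (Ioc 0 1 ×ˢ univ) :=
    contDiff_wedge.continuous.comp_continuousOn ((hcont x hxc hx).prodMk (hcont y hyc hy))
  have hperiodic : ∀ t : ℝ, Function.Periodic (fun θ => wedge (Φ (t * x θ)) (Φ (t * y θ)))
      (2 * π) := fun t θ => by simp only [hxp θ, hyp θ]
  have hne : ∀ t ∈ Ioc (0 : ℝ) 1, ∀ θ, wedge (Φ (t * x θ)) (Φ (t * y θ)) ≠ 0 := by
    intro t ht θ hzero
    have hxt := hmem t ht _ (hx θ)
    have hyt := hmem t ht _ (hy θ)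
    have heq := ((hΦ.isLift _ hxt).wedge_eq_zero_iff (hΦ.isLift _ hyt)).1 hzero
    have hclose : dist ((t : ℂ) * x θ) (t * y θ) < δ := by
      rw [dist_eq_norm, ← mul_sub, norm_mul, Complex.norm_of_nonneg ht.1.le, ← dist_eq_norm]
      exact (mul_le_of_le_one_left dist_nonneg ht.2).trans_lt (hdist θ)
    have hxy := mul_left_cancel₀ (Complex.ofReal_ne_zero.2 ht.1.ne') (hinj _ hxt _ hyt hclose heq)
    exact hn.ne_zero θ (by rw [hxy, sub_self])
  obtain ⟨r, hr, hr'⟩ := exists_between (lt_min hr₀ one_pos)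
  have hr₁ : r ∈ Ioc (0 : ℝ) 1 := ⟨hr, (hr'.trans_le (min_le_right _ _)).le⟩
  have hsmall : HasDegree (fun θ => wedge (Φ (r * x θ)) (Φ (r * y θ))) n :=
    hcenter r ⟨hr, hr'.trans_le (min_le_left _ _)⟩ x y n hx hy
      (hH.comp_continuous (f := fun θ : ℝ => (r, θ)) (by fun_prop) fun θ => ⟨hr₁, mem_univ θ⟩)
      (hperiodic r) hn
  simpa using HasDegree.of_isPreconnected (convex_Ioc 0 1).isPreconnected hH
    (fun t _ => hperiodic t) hne hr₁ (right_mem_Ioc.2 one_pos) hsmall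

lemma IsDistortedDisk.eventually_hasDegree_wedge {F : ℂ → Space} {Φ : ℂ → ℂ × ℂ}
    (hF : IsDistortedDisk F) (hΦ : IsLiftOn F Φ (closedBall 0 1)) {ψ : ℝ → ℝ}
    (hψ : Continuous ψ) (hm : StrictMono ψ) (hp : ∀ θ, ψ (θ + 2 * π) = ψ θ + 2 * π) :
    ∀ᶠ ε in 𝓝[>] (0 : ℝ), HasDegree (fun θ => wedge (Φ (Complex.exp (ψ θ * Complex.I)))
      (Φ (Complex.exp (ψ (θ + ε) * Complex.I)))) 1 := by
  obtain ⟨δ, hδ, hdegree⟩ := hF.exists_hasDegree_wedge hΦ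
  filter_upwards [eventually_sub_mem_Ioo hψ hm hp (lt_min hδ Real.pi_pos)] with ε hε
  have hperiodic := (HasDegree.exp_mul_I.comp hψ hp).periodic
  refine hdegree (fun θ => Complex.exp (ψ θ * Complex.I))
    (fun θ => Complex.exp (ψ (θ + ε) * Complex.I)) 1 (by fun_prop) (by fun_prop) hperiodic
    (fun θ => by simpa only [add_right_comm] using hperiodic (θ + ε))
    (fun θ => Complex.norm_exp_ofReal_mul_I _) (fun θ => Complex.norm_exp_ofReal_mul_I _)
    (fun θ => ?_) (.exp_sub_exp hψ hp fun θ => ⟨(hε θ).1, (hε θ).2.trans_le (min_le_right _ _)⟩)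
  rw [dist_comm, dist_eq_norm]
  refine (norm_exp_sub_exp_le _ _).trans_lt ?_
  rw [abs_of_pos (hε θ).1]
  exact (hε θ).2.trans_le (min_le_left _ _)

/-- `Γ` is a closed lift to `ℂ²` of the closed curve `γ` in the sphere. -/
structure IsCurveLift (γ : ℝ → Space) (Γ : ℝ → ℂ × ℂ) : Prop where
  continuous : Continuous Γ
  periodic : Function.Periodic Γ (2 * π)
  isLift : ∀ θ, IsLift (γ θ) (Γ θ)

/-- The lift `Γ` of a closed curve is simple: nearby points of `Γ` turn once around each other in
the projective line. This is what distinguishes the lifts of `γ` that come from distorted disks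
bounded by `γ`. -/
def IsSimpleLift (Γ : ℝ → ℂ × ℂ) : Prop :=
  ∀ᶠ ε in 𝓝[>] (0 : ℝ), HasDegree (fun θ => wedge (Γ θ) (Γ (θ + ε))) 1

lemma IsDistortedDisk.exists_isCurveLift {F : ℂ → Space} {γ : ℝ → Space} (hF : IsDistortedDisk F)
    (hγF : Bounds γ F) : ∃ Γ, IsCurveLift γ Γ ∧ IsSimpleLift Γ ∧
      ∀ P ∉ range γ, ∀ p, IsLift P p → (layers F P).Finite ∧
        HasDegree (fun θ => wedge p (Γ θ)) (layers F P).ncard := by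
  obtain ⟨Φ, hΦ⟩ := hF.exists_isLiftOn
  have hbounds := hγF
  obtain ⟨φ, hφ, hφm, hφp, hFφ⟩ := hbounds
  obtain ⟨ψ, hψ, hψm, hψp, hφψ⟩ := exists_inverse_of_strictMono_of_add_two_pi hφ hφm hφp
  have hmem : ∀ θ, Complex.exp (ψ θ * Complex.I) ∈ closedBall (0 : ℂ) 1 := fun θ =>
    sphere_subset_closedBall (exp_mul_I_mem_sphere _)
  refine ⟨fun θ => Φ (Complex.exp (ψ θ * Complex.I)), ⟨?_, fun θ => ?_, fun θ => ?_⟩,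
    hF.eventually_hasDegree_wedge hΦ hψ hψm hψp, fun P hP p hp => ?_⟩
  · exact hΦ.continuousOn.comp_continuous (by fun_prop) hmem
  · exact congrArg Φ ((HasDegree.exp_mul_I.comp hψ hψp).periodic θ)
  · have hlift := hΦ.isLift _ (hmem θ)
    rwa [hFφ, hφψ] at hlift
  · obtain ⟨hfinite, hdegree⟩ := hF.layers_hasDegree hΦ hp fun z => hγF.ne_of_mem_sphere hP
    exact ⟨hfinite, hdegree.comp hψ hψp⟩

lemma IsLift.hasDegree_wedge {Γ : ℝ → ℂ × ℂ} {P : Space} {p q : ℂ × ℂ} (hp : IsLift P p)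
    (hq : IsLift P q) {n : ℤ} (hn : HasDegree (fun θ => wedge p (Γ θ)) n) :
    HasDegree (fun θ => wedge q (Γ θ)) n := by
  have hpq := hp.wedge_eq_zero hq
  rw [← ratio_smul hp.ne_zero hpq]
  simpa only [wedge_smul_left, zero_add] using
    (HasDegree.const (ratio_ne_zero hp.ne_zero hq.ne_zero hpq)).mul hn

namespace IsCurveLift

variable {γ : ℝ → Space} {Γ Γ₁ Γ₂ : ℝ → ℂ × ℂ}

lemma exists_smul_eq (h₁ : IsCurveLift γ Γ₁) (h₂ : IsCurveLift γ Γ₂) :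
    ∃ (k : ℝ → ℂ) (n : ℤ), HasDegree k n ∧ ∀ θ, k θ • Γ₁ θ = Γ₂ θ := by
  have hwedge : ∀ θ, wedge (Γ₁ θ) (Γ₂ θ) = 0 := fun θ =>
    (h₁.isLift θ).wedge_eq_zero (h₂.isLift θ)
  have hcont : Continuous fun θ => ratio (Γ₁ θ) (Γ₂ θ) := continuous_iff_continuousAt.2 fun θ =>
    continuousAt_ratio h₁.continuous.continuousAt h₂.continuous.continuousAt (h₁.isLift θ).ne_zero
  obtain ⟨n, hn⟩ := exists_hasDegree hcont
    (fun θ => by simp only [h₁.periodic θ, h₂.periodic θ])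
    fun θ => ratio_ne_zero (h₁.isLift θ).ne_zero (h₂.isLift θ).ne_zero (hwedge θ)
  exact ⟨_, n, hn, fun θ => ratio_smul (h₁.isLift θ).ne_zero (hwedge θ)⟩

/-- Two lifts of `γ` differ by a factor of some degree `d`. Multiplying by it changes the degree of
`wedge (Γ θ) (Γ (θ + ε))` by `2 * d`, so simplicity forces `d = 0`. -/
lemma eq_of_isSimpleLift (h₁ : IsCurveLift γ Γ₁) (h₂ : IsCurveLift γ Γ₂)
    (hs₁ : IsSimpleLift Γ₁) (hs₂ : IsSimpleLift Γ₂) {p : ℂ × ℂ} {m n : ℤ}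
    (hm : HasDegree (fun θ => wedge p (Γ₁ θ)) m) (hn : HasDegree (fun θ => wedge p (Γ₂ θ)) n) :
    m = n := by
  obtain ⟨k, d, hk, hkΓ⟩ := h₁.exists_smul_eq h₂
  obtain ⟨ε, hε₁, hε₂⟩ := (Filter.Eventually.and hs₁ hs₂).exists
  simp only [← hkΓ, wedge_smul_left, wedge_smul_right] at hε₂ hn
  have hkε : HasDegree (fun θ => k (θ + ε)) d :=
    hk.comp (φ := fun θ => θ + ε) (by fun_prop) fun θ => by ring
  have hd := (hkε.mul (hk.mul hε₁)).unique hε₂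
  have hmn := (hk.mul hm).unique hn
  omega

/-- On the complement of `γ 0`, and so on `Ω`, the map `P ↦ proj P q` is a continuous lift, where
`q` is a lift of `-γ 0`. -/
lemma exists_hasDegree_of_isPreconnected (hΓ : IsCurveLift γ Γ) (hγ : range γ ⊆ domain)
    {Ω : Set Space} (hΩ : IsPreconnected Ω) (hΩγ : Ω ⊆ domain \ range γ) :
    ∃ n : ℤ, ∀ P ∈ Ω, ∀ p, IsLift P p → HasDegree (fun θ => wedge p (Γ θ)) n := by
  obtain rfl | ⟨P₀, hP₀⟩ := Ω.eq_empty_or_nonempty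
  · exact ⟨0, fun P hP => hP.elim⟩
  have hγ₀ : -γ 0 ∈ domain := by simpa [domain] using hγ (mem_range_self 0)
  obtain ⟨q, hq⟩ := exists_isLift hγ₀
  have hlift : ∀ P ∈ Ω, IsLift P (proj P q) := fun P hP =>
    hq.proj (hΩγ hP).1 fun h => (hΩγ hP).2 ⟨0, neg_injective h⟩
  have hne : ∀ P ∈ Ω, ∀ θ, wedge (proj P q) (Γ θ) ≠ 0 := fun P hP θ h =>
    (hΩγ hP).2 ⟨θ, (((hlift P hP).wedge_eq_zero_iff (hΓ.isLift θ)).1 h).symm⟩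
  have hproj : Continuous fun P => proj P q := by
    unfold proj
    fun_prop
  have hH : Continuous (Function.uncurry fun P θ => wedge (proj P q) (Γ θ)) :=
    continuous_wedge (hproj.comp continuous_fst) (hΓ.continuous.comp continuous_snd)
  have hperiodic : ∀ P, Function.Periodic (fun θ => wedge (proj P q) (Γ θ)) (2 * π) := fun P θ =>
    congrArg (wedge (proj P q)) (hΓ.periodic θ)
  obtain ⟨n, hn⟩ := exists_hasDegree (hH.comp (Continuous.prodMk_right P₀)) (hperiodic P₀)
    (hne P₀ hP₀)
  exact ⟨n, fun P hP p hp => (hlift P hP).hasDegree_wedge hp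
    (.of_isPreconnected hΩ hH.continuousOn (fun P _ => hperiodic P) hne hP₀ hP hn)⟩

end IsCurveLift

end Sphere

/-! ### The area of the sphere -/

namespace Sphere

/-- The area measure of the sphere, as a measure on the ambient space. -/
noncomputable def areaMeasure : Measure Space :=
  (volume : Measure Space).toSphere.map Subtype.val

lemma areaMeasure_apply (Ω : Set Space) : areaMeasure Ω = setArea Ω :=
  (MeasurableEmbedding.subtype_coe isClosed_sphere.measurableSet).map_apply _ _

lemma areaMeasure_eq_three_mul_volume {Ω : Set Space} (hm : MeasurableSet Ω) (hΩ : Ω ⊆ domain) :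
    areaMeasure Ω = 3 * volume ((fun q : ℝ × Space => q.1 • q.2) '' (Ioo 0 1 ×ˢ Ω)) := by
  rw [areaMeasure_apply, setArea, Measure.toSphere_apply' _ (measurable_subtype_coe hm),
    finrank_euclideanSpace_fin, image_prod, Subtype.image_preimage_coe,
    show sphere (0 : Space) 1 ∩ Ω = Ω from inter_eq_right.2 hΩ, image2_smul, Nat.cast_ofNat]

instance : IsFiniteMeasure areaMeasure := by
  unfold areaMeasure
  infer_instance

lemma areaMeasure_domain : areaMeasure domain = areaMeasure univ := by
  rw [areaMeasure_apply, areaMeasure_apply, setArea, setArea, preimage_univ]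
  congr 1
  exact eq_univ_of_forall fun x => x.2

lemma areaMeasure_univ_ne_zero : areaMeasure univ ≠ 0 := by
  rw [areaMeasure_apply, setArea, preimage_univ, Measure.measure_univ_ne_zero]
  exact Measure.toSphere_ne_zero _

lemma areaMeasure_range {γ : ℝ → Space} (hγ : IsClosedCurve γ) (hγd : range γ ⊆ domain) :
    areaMeasure (range γ) = 0 := by
  rw [areaMeasure_eq_three_mul_volume hγ.isCompact_range.isClosed.measurableSet hγd]
  obtain ⟨n, t, hrange, ht⟩ := hγ.exists_range_eq_biUnion
  refine mul_eq_zero_of_right _ ?_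
  rw [hrange, prod_iUnion₂, image_iUnion₂, measure_biUnion_null_iff (finite_Ico 0 n).countable]
  intro i hi
  have hcone : ContDiffOn ℝ 1 (fun q : ℝ × ℝ => q.1 • γ q.2) (Ioo 0 1 ×ˢ Ioc (t i) (t (i + 1))) :=
    contDiff_fst.contDiffOn.smul ((ht i hi).comp contDiff_snd.contDiffOn fun q hq => hq.2)
  refine measure_mono_null ?_ (addHaar_image_eq_zero_of_finrank_lt volume hcone
    ((convex_Ioo _ _).prod (convex_Ioc _ _)) (by simp))
  rintro _ ⟨⟨r, _⟩, ⟨hr, θ, hθ, rfl⟩, rfl⟩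
  exact ⟨(r, θ), ⟨hr, hθ⟩, rfl⟩

/-- The projection of space to the plane of the first two coordinates. -/
noncomputable def planeProj : Space →L[ℝ] ℂ :=
  LinearMap.toContinuousLinearMap
    { toFun := fun v => v 0 + v 1 * Complex.I
      map_add' := fun u v => by
        simp only [PiLp.add_apply, Complex.ofReal_add]
        ring
      map_smul' := fun c v => by
        simp only [PiLp.smul_apply, smul_eq_mul, Complex.ofReal_mul, RingHom.id_apply,
          Complex.real_smul]
        ring }

lemma planeProj_apply (v : Space) : planeProj v = v 0 + v 1 * Complex.I := rfl

/-- Space as the product of the line of the last coordinate and the plane of the first two. -/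
noncomputable def splitEquiv : Space ≃ᵐ ℝ × ℂ :=
  (MeasurableEquiv.toLp 2 (Fin 3 → ℝ)).symm.trans
    ((MeasurableEquiv.piFinSuccAbove (fun _ => ℝ) 2).trans
      ((MeasurableEquiv.refl ℝ).prodCongr Complex.measurableEquivPi.symm))

lemma splitEquiv_apply (x : Space) : splitEquiv x = (x 2, planeProj x) := by
  refine Prod.ext rfl ?_
  change Complex.measurableEquivPi.symm (Fin.removeNth 2 x.ofLp) = _
  rw [Complex.measurableEquivPi_symm_apply]
  rfl

lemma measurePreserving_splitEquiv : MeasurePreserving splitEquiv :=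
  ((MeasurePreserving.id (volume : Measure ℝ)).prod
    (Complex.volume_preserving_equiv_pi.symm Complex.measurableEquivPi)).comp
    ((volume_preserving_piFinSuccAbove (fun _ : Fin 3 => ℝ) 2).comp
      (PiLp.volume_preserving_ofLp (Fin 3)))

/-- The cone over a map `F` of the plane, as a map of space `(t, z) ↦ t • F z`. It reduces the area
of the image of `F`, which is three times the volume of the cone over it, to a volume. -/
noncomputable def cone (F : ℂ → Space) (x : Space) : Space := x 2 • F (planeProj x)

section Cone

variable {F : ℂ → Space} {A : Set ℂ}

lemma mem_splitEquiv_preimage {x : Space} :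
    x ∈ splitEquiv ⁻¹' (Ioo 0 1 ×ˢ A) ↔ x 2 ∈ Ioo (0 : ℝ) 1 ∧ planeProj x ∈ A := by
  rw [mem_preimage, splitEquiv_apply, mem_prod]

lemma cone_image (F : ℂ → Space) (A : Set ℂ) : cone F '' (splitEquiv ⁻¹' (Ioo 0 1 ×ˢ A)) =
    (fun q : ℝ × Space => q.1 • q.2) '' (Ioo 0 1 ×ˢ (F '' A)) := by
  have hcone : cone F = (fun q : ℝ × Space => q.1 • q.2) ∘ Prod.map id F ∘ splitEquiv := by
    funext x
    simp only [Function.comp_apply, splitEquiv_apply, Prod.map_apply, id, cone]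
  rw [hcone, image_comp, image_comp, image_preimage_eq _ splitEquiv.surjective, prodMap_image_prod,
    image_id]

lemma injOn_cone (hF : InjOn F A) (hFd : MapsTo F A domain) :
    InjOn (cone F) (splitEquiv ⁻¹' (Ioo 0 1 ×ˢ A)) := by
  intro x hx y hy hxy
  rw [mem_splitEquiv_preimage] at hx hy
  have hnorm := congrArg norm hxy
  rw [cone, cone, norm_smul, norm_smul, mem_sphere_zero_iff_norm.1 (hFd hx.2),
    mem_sphere_zero_iff_norm.1 (hFd hy.2), Real.norm_of_nonneg hx.1.1.le,
    Real.norm_of_nonneg hy.1.1.le, mul_one, mul_one] at hnorm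
  rw [cone, cone, hnorm] at hxy
  refine splitEquiv.injective ?_
  rw [splitEquiv_apply, splitEquiv_apply, hnorm,
    hF hx.2 hy.2 (smul_right_injective _ hy.1.1.ne' hxy)]

lemma hasFDerivAt_cone {F' : ℂ →L[ℝ] Space} {x : Space} (hF : HasFDerivAt F F' (planeProj x)) :
    HasFDerivAt (cone F) (x 2 • F'.comp planeProj +
      (EuclideanSpace.proj 2 : Space →L[ℝ] ℝ).smulRight (F (planeProj x))) x :=
  HasFDerivAt.smul (EuclideanSpace.proj 2 : Space →L[ℝ] ℝ).hasFDerivAt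
    (hF.comp x planeProj.hasFDerivAt)

lemma det_fderiv_cone (F' : ℂ →L[ℝ] Space) (v x : Space) :
    (x 2 • F'.comp planeProj + (EuclideanSpace.proj 2 : Space →L[ℝ] ℝ).smulRight v).det =
      x 2 ^ 2 * det₃ v (F' 1) (F' Complex.I) := by
  rw [ContinuousLinearMap.det,
    ← LinearMap.det_toMatrix (EuclideanSpace.basisFun (Fin 3) ℝ).toBasis, Matrix.det_fin_three,
    det₃_eq]
  simp [LinearMap.toMatrix_apply, planeProj_apply]
  ring

lemma lintegral_Ioo_sq : ∫⁻ t in Ioo (0 : ℝ) 1, ENNReal.ofReal (t ^ 2) = 3⁻¹ := by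
  rw [← ofReal_integral_eq_lintegral_ofReal
      ((continuous_pow 2).integrableOn_Icc.mono_set Ioo_subset_Icc_self)
      (.of_forall fun t => sq_nonneg t),
    ← integral_Ioc_eq_integral_Ioo, ← intervalIntegral.integral_of_le zero_le_one, integral_pow]
  norm_num
  rw [one_div, ENNReal.ofReal_inv_of_pos three_pos, ENNReal.ofReal_ofNat]

lemma lintegral_splitEquiv_preimage {J : ℂ → ℝ} (hA : MeasurableSet A)
    (hJ : AEMeasurable J (volume.restrict A)) :
    3 * ∫⁻ x in splitEquiv ⁻¹' (Ioo 0 1 ×ˢ A), ENNReal.ofReal |x 2 ^ 2 * J (planeProj x)| =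
      ∫⁻ z in A, ENNReal.ofReal |J z| := by
  have hsplit : ∀ x ∈ splitEquiv ⁻¹' (Ioo 0 1 ×ˢ A), ENNReal.ofReal |x 2 ^ 2 * J (planeProj x)| =
      (fun q : ℝ × ℂ => ENNReal.ofReal (q.1 ^ 2) * ENNReal.ofReal |J q.2|) (splitEquiv x) :=
    fun x _ => by
      rw [splitEquiv_apply, abs_mul, abs_of_nonneg (sq_nonneg _),
        ENNReal.ofReal_mul (sq_nonneg _)]
  rw [setLIntegral_congr_fun (splitEquiv.measurable (measurableSet_Ioo.prod hA)) hsplit,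
    measurePreserving_splitEquiv.setLIntegral_comp_preimage_emb splitEquiv.measurableEmbedding
      (fun q : ℝ × ℂ => ENNReal.ofReal (q.1 ^ 2) * ENNReal.ofReal |J q.2|),
    Measure.volume_eq_prod, ← Measure.prod_restrict,
    lintegral_prod_mul (f := fun t : ℝ => ENNReal.ofReal (t ^ 2))
      (g := fun z => ENNReal.ofReal |J z|) (by fun_prop) hJ.abs.ennreal_ofReal,
    lintegral_Ioo_sq, ← mul_assoc, ENNReal.mul_inv_cancel (by norm_num) (by norm_num), one_mul]

theorem areaMeasure_image {U : Set ℂ} (hU : IsOpen U) (hF : ContDiffOn ℝ 1 F U) (hAU : A ⊆ U)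
    (hA : MeasurableSet A) (hAF : InjOn F A) (hFd : MapsTo F A domain) :
    areaMeasure (F '' A) =
      ∫⁻ z in A, ENNReal.ofReal |det₃ (F z) (fderiv ℝ F z 1) (fderiv ℝ F z Complex.I)| := by
  have hderiv : ∀ z ∈ A, HasFDerivAt F (fderiv ℝ F z) z := fun z hz =>
    ((hF.contDiffAt (hU.mem_nhds (hAU hz))).differentiableAt one_ne_zero).hasFDerivAt
  have hJ : ContinuousOn (fun z => det₃ (F z) (fderiv ℝ F z 1) (fderiv ℝ F z Complex.I)) U := by
    have hfderiv := hF.continuousOn_fderiv_of_isOpen hU le_rfl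
    have := hfderiv.clm_apply (continuousOn_const (c := (1 : ℂ)))
    have := hfderiv.clm_apply (continuousOn_const (c := Complex.I))
    have := hF.continuousOn
    simp only [det₃_eq]
    fun_prop
  rw [areaMeasure_eq_three_mul_volume
      (hA.image_of_continuousOn_injOn (hF.continuousOn.mono hAU) hAF) hFd.image_subset,
    ← cone_image, ← lintegral_abs_det_fderiv_eq_addHaar_image volume
      (splitEquiv.measurable (measurableSet_Ioo.prod hA))
      (fun x hx => (hasFDerivAt_cone
        (hderiv _ (mem_splitEquiv_preimage.1 hx).2)).hasFDerivWithinAt)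
      (injOn_cone hAF hFd)]
  simp only [det_fderiv_cone]
  exact lintegral_splitEquiv_preimage hA ((hJ.mono hAU).aemeasurable hA)

end Cone

lemma inner_eq (u v : Space) : inner ℝ u v = u 0 * v 0 + u 1 * v 1 + u 2 * v 2 := by
  rw [PiLp.inner_apply, Fin.sum_univ_three]
  simp [mul_comm]

/-- Both sides are the Gram determinant of `v`, `a`, `b`, as `v` is a unit vector normal to `a` and
`b`. -/
lemma det₃_sq {v a b : Space} (hv : v ∈ domain) (ha : inner ℝ v a = 0) (hb : inner ℝ v b = 0) :
    det₃ v a b ^ 2 = inner ℝ a a * inner ℝ b b - inner ℝ a b * inner ℝ b a := by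
  have hsum := mem_domain_iff.1 hv
  rw [inner_eq] at ha hb
  rw [det₃_eq, inner_eq, inner_eq, inner_eq, inner_eq]
  linear_combination
    ((a 0 ^ 2 + a 1 ^ 2 + a 2 ^ 2) * (b 0 ^ 2 + b 1 ^ 2 + b 2 ^ 2) -
      (a 0 * b 0 + a 1 * b 1 + a 2 * b 2) ^ 2) * hsum -
    ((v 0 * a 0 + v 1 * a 1 + v 2 * a 2) * (b 0 ^ 2 + b 1 ^ 2 + b 2 ^ 2) -
      (a 0 * b 0 + a 1 * b 1 + a 2 * b 2) * (v 0 * b 0 + v 1 * b 1 + v 2 * b 2)) * ha +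
    ((v 0 * a 0 + v 1 * a 1 + v 2 * a 2) * (a 0 * b 0 + a 1 * b 1 + a 2 * b 2) -
      (a 0 ^ 2 + a 1 ^ 2 + a 2 ^ 2) * (v 0 * b 0 + v 1 * b 1 + v 2 * b 2)) * hb

namespace IsDistortedDisk

variable {F : ℂ → Space}

lemma inner_fderiv (hF : IsDistortedDisk F) {z : ℂ} (hz : z ∈ ball (0 : ℂ) 1) (u : ℂ) :
    inner ℝ (F z) (fderiv ℝ F z u) = 0 := by
  have hsq := ((hF.contDiffAt hz).differentiableAt one_ne_zero).hasFDerivAt.norm_sq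
  have hconst : HasFDerivAt (fun z => ‖F z‖ ^ 2) (0 : ℂ →L[ℝ] ℝ) z := by
    refine (hasFDerivAt_const (1 : ℝ) z).congr_of_eventuallyEq ?_
    filter_upwards [isOpen_ball.mem_nhds hz] with x hx
    rw [mem_sphere_zero_iff_norm.1 (hF.mapsTo (ball_subset_closedBall hx)), one_pow]
  simpa using congrArg (fun L : ℂ →L[ℝ] ℝ => L u) (hsq.unique hconst)

lemma area_eq_lintegral_count (hF : IsDistortedDisk F) :
    area F = ∫⁻ P, Measure.count (layers F P) ∂areaMeasure := by
  have hinj : ∀ z ∈ ball (0 : ℂ) 1, ∃ V ∈ 𝓝 z, InjOn F V := fun z hz =>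
    let ⟨U, hU, hUF⟩ := hF.exists_injOn hz
    ⟨_, Filter.inter_mem hU (Filter.mem_of_superset (isOpen_ball.mem_nhds hz)
      ball_subset_closedBall), hUF⟩
  refine lintegral_eq_lintegral_count isOpen_ball (hF.continuousOn.mono ball_subset_closedBall)
    hinj fun A hA hAm hAF => ?_
  have hmaps : MapsTo F A domain := fun z hz => hF.mapsTo (ball_subset_closedBall (hA hz))
  rw [areaMeasure_image isOpen_ball hF.contDiffOn hA hAm hAF hmaps]
  refine setLIntegral_congr_fun hAm fun z hz => ?_
  simp only [pullbackMetric, one_mul]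
  rw [← Real.sqrt_sq_eq_abs,
    det₃_sq (hmaps hz) (hF.inner_fderiv (hA hz) 1) (hF.inner_fderiv (hA hz) Complex.I)]

end IsDistortedDisk

end Sphere

lemma IsClosedCurve.comp_contDiffOn {E E' : Type*} [NormedAddCommGroup E] [NormedSpace ℝ E]
    [NormedAddCommGroup E'] [NormedSpace ℝ E'] {γ : ℝ → E} (hγ : IsClosedCurve γ) {f : E → E'}
    {s : Set E} (hs : range γ ⊆ s) (hf : ContDiffOn ℝ 1 f s) :
    IsClosedCurve (fun θ => f (γ θ)) where
  continuous := hf.continuousOn.comp_continuous hγ.continuous fun θ => hs ⟨θ, rfl⟩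
  periodic θ := by rw [hγ.periodic]
  piecewise := by
    obtain ⟨n, t, ht₀, htn, hmono, ht⟩ := hγ.piecewise
    exact ⟨n, t, ht₀, htn, hmono, fun i hi => hf.comp (ht i hi) fun θ _ => hs ⟨θ, rfl⟩⟩

namespace Sphere

variable {γ : ℝ → Space} {F : ℂ → Space}

/-! ### Rotations -/

lemma det₃_eq_basis_det (f : Fin 3 → Space) :
    det₃ (f 0) (f 1) (f 2) = (EuclideanSpace.basisFun (Fin 3) ℝ).toBasis.det f := by
  rw [Module.Basis.det_apply, Matrix.det_fin_three, det₃_eq]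
  simp only [Module.Basis.toMatrix_apply, OrthonormalBasis.coe_toBasis_repr_apply,
    EuclideanSpace.basisFun_repr]
  ring

lemma det₃_map (R : Space →ₗ[ℝ] Space) (u v w : Space) :
    det₃ (R u) (R v) (R w) = LinearMap.det R * det₃ u v w :=
  (det₃_eq_basis_det (R ∘ ![u, v, w])).trans <| (Module.Basis.det_comp _ R _).trans <|
    congrArg _ (det₃_eq_basis_det ![u, v, w]).symm

lemma det_reflection_span {m : Space} (hm : m ≠ 0) :
    LinearMap.det (ℝ ∙ m).reflection.toLinearMap = 1 := by
  have : Fact (Module.finrank ℝ Space = 2 + 1) := ⟨by simp⟩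
  rw [Submodule.det_reflection, Submodule.finrank_orthogonal_span_singleton (n := 2) hm]
  norm_num

lemma exists_reflection_span_eq_infinity {P : Space} (hP : P ∈ domain) :
    ∃ m : Space, m ≠ 0 ∧ (ℝ ∙ m).reflection P = infinity := by
  by_cases hsum : P + infinity = 0
  · refine ⟨!₂[1, 0, 0], fun h => ?_, ?_⟩
    · simpa using congrArg (fun v : Space => v 0) h
    · rw [Submodule.reflection_mem_subspace_orthogonalComplement_eq_neg]
      · exact (eq_neg_of_add_eq_zero_right hsum).symm
      · rw [Submodule.mem_orthogonal_singleton_iff_inner_right, eq_neg_of_add_eq_zero_left hsum,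
          inner_eq]
        simp [infinity]
  · refine ⟨P + infinity, hsum, ?_⟩
    have hnorm : ‖P‖ = ‖-infinity‖ := by
      rw [norm_neg, mem_sphere_zero_iff_norm.1 hP, mem_sphere_zero_iff_norm.1 infinity_mem]
    have hrefl := Submodule.reflection_sub hnorm
    rw [sub_neg_eq_add, Submodule.reflection_orthogonal_apply] at hrefl
    exact neg_injective hrefl

lemma exists_rotation {P : Space} (hP : P ∈ domain) : ∃ R : Space ≃ₗᵢ[ℝ] Space, R P = infinity ∧
    ∀ u v w, det₃ (R u) (R v) (R w) = det₃ u v w := by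
  obtain ⟨m, hm, hmP⟩ := exists_reflection_span_eq_infinity hP
  exact ⟨(ℝ ∙ m).reflection, hmP, fun u v w =>
    (det₃_map (ℝ ∙ m).reflection.toLinearMap u v w).trans (by
      rw [det_reflection_span hm, one_mul])⟩

lemma map_mem_domain (R : Space ≃ₗᵢ[ℝ] Space) {P : Space} (hP : P ∈ domain) : R P ∈ domain := by
  rw [domain, mem_sphere_zero_iff_norm, R.norm_map]
  exact mem_sphere_zero_iff_norm.1 hP

lemma IsDistortedDisk.rotate (hF : IsDistortedDisk F) (R : Space ≃ₗᵢ[ℝ] Space)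
    (hR : ∀ u v w, det₃ (R u) (R v) (R w) = det₃ u v w) : IsDistortedDisk (R ∘ F) where
  continuousOn := R.continuous.comp_continuousOn hF.continuousOn
  mapsTo _ hz := map_mem_domain R (hF.mapsTo hz)
  contDiffOn := R.contDiff.comp_contDiffOn hF.contDiffOn
  det_pos z hz := by
    rw [R.comp_fderiv']
    exact (hF.det_pos z hz).trans_eq (hR (F z) (fderiv ℝ F z 1) (fderiv ℝ F z Complex.I)).symm
  locally_injective z hz := by
    obtain ⟨U, hU, hinj⟩ := hF.locally_injective z hz
    exact ⟨U, hU, R.injective.comp_injOn hinj⟩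

lemma area_rotate (F : ℂ → Space) (R : Space ≃ₗᵢ[ℝ] Space) : area (R ∘ F) = area F := by
  unfold area diskArea pullbackMetric
  simp [R.comp_fderiv']

/-! ### The stereographic projection -/

/-- The inverse of the projective coordinate `coord`. -/
noncomputable def invCoord (w : ℂ) : Space :=
  !₂[2 * w.re / (1 + w.re ^ 2 + w.im ^ 2), 2 * w.im / (1 + w.re ^ 2 + w.im ^ 2),
    (1 - w.re ^ 2 - w.im ^ 2) / (1 + w.re ^ 2 + w.im ^ 2)]

lemma one_add_re_sq_add_im_sq_ne_zero (w : ℂ) : 1 + w.re ^ 2 + w.im ^ 2 ≠ 0 := by positivity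

lemma invCoord_mem (w : ℂ) : invCoord w ∈ domain := by
  have := one_add_re_sq_add_im_sq_ne_zero w
  rw [mem_domain_iff]
  simp only [invCoord, PiLp.toLp_apply, Matrix.cons_val]
  field_simp
  ring

lemma isLift_invCoord (w : ℂ) : IsLift (invCoord w) (1, w) := by
  have hden : (1 + w.re ^ 2 + w.im ^ 2 : ℂ) ≠ 0 := by
    exact_mod_cast one_add_re_sq_add_im_sq_ne_zero w
  have hw := Complex.re_add_im w
  refine .of_eq (by simp) ?_ ?_
  · simp only [invCoord, PiLp.toLp_apply, Matrix.cons_val]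
    push_cast
    field_simp
    linear_combination 2 * hw
  · simp only [invCoord, PiLp.toLp_apply, Matrix.cons_val]
    push_cast
    field_simp
    linear_combination (-2 * (w.re - w.im * Complex.I)) * hw - 2 * w.im ^ 2 * Complex.I_sq

lemma invCoord_ne_infinity (w : ℂ) : invCoord w ≠ infinity := fun h => by
  simpa [wedge] using ((isLift_invCoord w).wedge_eq_zero_iff isLift_infinity).2 h

lemma coord_invCoord (w : ℂ) : coord (invCoord w) = w := by
  have h := (isLift_invCoord w).wedge_eq_zero
    (isLift_coord (invCoord_mem w) (invCoord_ne_infinity w))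
  simpa [wedge, sub_eq_zero] using h

lemma invCoord_coord {P : Space} (hP : P ∈ domain) (h : P ≠ infinity) : invCoord (coord P) = P :=
  (isLift_invCoord _).unique (isLift_coord hP h)

lemma injective_invCoord : Function.Injective invCoord :=
  Function.LeftInverse.injective coord_invCoord

lemma contDiff_invCoord : ContDiff ℝ 1 invCoord := by
  have : ContDiff ℝ 1 Complex.re := Complex.reCLM.contDiff
  have : ContDiff ℝ 1 Complex.im := Complex.imCLM.contDiff
  rw [contDiff_euclidean]
  intro i
  fin_cases i <;>
    exact ContDiff.div (by fun_prop) (by fun_prop) one_add_re_sq_add_im_sq_ne_zero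

lemma contDiffOn_coord : ContDiffOn ℝ 1 coord {v | 1 + v 2 ≠ 0} := by
  have h : ∀ i, ContDiff ℝ 1 (fun v : Space => (v i : ℂ)) := fun i =>
    (Complex.ofRealCLM.comp (EuclideanSpace.proj i : Space →L[ℝ] ℝ)).contDiff
  refine ((h 0).add ((h 1).mul contDiff_const)).contDiffOn.mul
    ((contDiff_const.add (h 2)).contDiffOn.inv fun v hv => ?_)
  simpa using Complex.ofReal_ne_zero.2 hv

lemma measurable_coord : Measurable coord := by
  unfold coord
  fun_prop

lemma continuous_det₃ {X : Type*} [TopologicalSpace X] {f g h : X → Space} (hf : Continuous f)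
    (hg : Continuous g) (hh : Continuous h) : Continuous fun x => det₃ (f x) (g x) (h x) := by
  simp only [det₃_eq]
  fun_prop

lemma measurableSet_invCoord_image {s : Set ℂ} (hs : MeasurableSet s) :
    MeasurableSet (invCoord '' s) :=
  hs.image_of_continuousOn_injOn contDiff_invCoord.continuous.continuousOn injective_invCoord.injOn

lemma exists_map_coord_le (R : ℝ) : ∃ C : ℝ,
    (areaMeasure.restrict (invCoord '' ball 0 R)).map coord ≤
      ENNReal.ofReal C • volume.restrict (ball 0 R) := by
  have hderiv := contDiff_invCoord.continuous_fderiv one_ne_zero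
  have hJ := continuous_det₃ contDiff_invCoord.continuous
    (hderiv.clm_apply (continuous_const (y := (1 : ℂ))))
    (hderiv.clm_apply (continuous_const (y := Complex.I)))
  obtain ⟨C, hC⟩ := (isCompact_closedBall (0 : ℂ) R).exists_bound_of_continuousOn hJ.continuousOn
  refine ⟨C, Measure.le_iff.2 fun s hs => ?_⟩
  have hpreimage : coord ⁻¹' s ∩ invCoord '' ball 0 R = invCoord '' (s ∩ ball 0 R) := by
    rw [inter_comm, ← image_inter_preimage, ← preimage_comp,
      show coord ∘ invCoord = id from funext coord_invCoord, preimage_id, inter_comm]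
  have hm := hs.inter (measurableSet_ball (x := (0 : ℂ)) (ε := R))
  rw [Measure.map_apply measurable_coord hs, Measure.restrict_apply (measurable_coord hs),
    hpreimage, areaMeasure_image isOpen_univ contDiff_invCoord.contDiffOn (subset_univ _) hm
      injective_invCoord.injOn fun w _ => invCoord_mem w,
    Measure.smul_apply, Measure.restrict_apply hs, smul_eq_mul, ← setLIntegral_const]
  exact setLIntegral_mono' hm fun w hw =>
    ENNReal.ofReal_le_ofReal (hC w (ball_subset_closedBall hw.2))

lemma lintegral_coord_ne_top {R : ℝ} {f : ℂ → ENNReal} (hf : Measurable f)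
    (h : ∫⁻ w in ball 0 R, f w ≠ ⊤) :
    ∫⁻ P in invCoord '' ball 0 R, f (coord P) ∂areaMeasure ≠ ⊤ := by
  obtain ⟨C, hC⟩ := exists_map_coord_le R
  rw [← lintegral_map hf measurable_coord]
  refine ne_top_of_le_ne_top ?_ (lintegral_mono' hC le_rfl)
  rw [lintegral_smul_measure, smul_eq_mul]
  exact ENNReal.mul_ne_top ENNReal.ofReal_ne_top h

lemma isClosedCurve_coord (hγ : IsClosedCurve γ) (hγd : range γ ⊆ domain)
    (h : infinity ∉ range γ) : IsClosedCurve (fun θ => coord (γ θ)) :=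
  hγ.comp_contDiffOn (s := {v | 1 + v 2 ≠ 0})
    (fun _ hv => one_add_ne_zero (hγd hv) fun h₀ => h (h₀ ▸ hv)) contDiffOn_coord

lemma IsCurveLift.hasDegree_coord_sub {Γ : ℝ → ℂ × ℂ} (hΓ : IsCurveLift γ Γ)
    (hγd : range γ ⊆ domain) (h : infinity ∉ range γ) {w : ℂ} {m n : ℤ}
    (hm : HasDegree (fun θ => wedge (1, w) (Γ θ)) m)
    (hn : HasDegree (fun θ => wedge (0, 1) (Γ θ)) n) :
    HasDegree (fun θ => coord (γ θ) - w) (m - n) := by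
  convert (hm.div hn).mul (HasDegree.const (c := -1) (by norm_num)) using 1
  · funext θ
    have hθ := (isLift_coord (hγd ⟨θ, rfl⟩) fun h₀ => h ⟨θ, h₀⟩).wedge_eq_zero (hΓ.isLift θ)
    have hne := hn.ne_zero θ
    simp only [wedge] at hθ hne ⊢
    rw [div_mul_eq_mul_div, eq_div_iff hne]
    linear_combination hθ
  · rw [add_zero]

/-! ### Finiteness of the area -/

namespace IsDistortedDisk

lemma layers_eq_empty (hF : IsDistortedDisk F) {P : Space} (hP : P ∉ domain) : layers F P = ∅ :=
  layers_eq_empty_of_notMem fun h => hP (hF.mapsTo.image_subset h)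

lemma hasDegree_coord_sub (hF : IsDistortedDisk F) (hγd : range γ ⊆ domain)
    (h : infinity ∉ range γ) (hγF : Bounds γ F) {P : Space} (hP : P ∈ domain \ range γ)
    (hPi : P ≠ infinity) :
    HasDegree (fun θ => coord (γ θ) - coord P)
      ((layers F P).ncard - (layers F infinity).ncard) := by
  obtain ⟨Γ, hΓ, -, hlayers⟩ := hF.exists_isCurveLift hγF
  exact hΓ.hasDegree_coord_sub hγd h (hlayers P hP.2 _ (isLift_coord hP.1 hPi)).2
    (hlayers _ h _ isLift_infinity).2

lemma finite_layers (hF : IsDistortedDisk F) (hγF : Bounds γ F) {P : Space}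
    (hP : P ∈ domain \ range γ) : (layers F P).Finite := by
  obtain ⟨Γ, -, -, hlayers⟩ := hF.exists_isCurveLift hγF
  obtain ⟨p, hp⟩ := exists_isLift hP.1
  exact (hlayers P hP.2 p hp).1

lemma count_layers_le (hF : IsDistortedDisk F) (hγ : IsClosedCurve γ) (hγd : range γ ⊆ domain)
    (h : infinity ∉ range γ) (hγF : Bounds γ F) {R : ℝ}
    (hR : (range fun θ => coord (γ θ)) ⊆ ball 0 R) {P : Space} (hP : P ∉ range γ) :
    Measure.count (layers F P) ≤ (layers F infinity).ncard + (invCoord '' ball 0 R).indicator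
      (fun P => ‖windingNumber (fun θ => coord (γ θ)) (coord P)‖ₑ) P := by
  have hc := isClosedCurve_coord hγ hγd h
  by_cases hPd : P ∈ domain
  swap
  · simp [hF.layers_eq_empty hPd]
  rw [count_layers (hF.finite_layers hγF ⟨hPd, hP⟩)]
  obtain rfl | hPi := eq_or_ne P infinity
  · exact le_self_add
  have hdegree := hF.hasDegree_coord_sub hγd h hγF ⟨hPd, hP⟩ hPi
  by_cases hPR : P ∈ invCoord '' ball 0 R
  · rw [indicator_of_mem hPR, hc.windingNumber_eq hdegree, ← ofReal_norm, Complex.norm_intCast,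
      ← ENNReal.ofReal_natCast, ← ENNReal.ofReal_natCast,
      ← ENNReal.ofReal_add (Nat.cast_nonneg _) (abs_nonneg _)]
    refine ENNReal.ofReal_le_ofReal ?_
    push_cast
    linarith [le_abs_self (((layers F P).ncard : ℝ) - (layers F infinity).ncard)]
  · have hPR' : R ≤ ‖coord P‖ := not_lt.1 fun hlt =>
      hPR ⟨coord P, mem_ball_zero_iff.2 hlt, invCoord_coord hPd hPi⟩
    have heq := hdegree.unique (hc.hasDegree_sub_zero hR hPR')
    rw [show (layers F P).ncard = (layers F infinity).ncard by lia]
    exact le_self_add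

lemma area_ne_top_of_infinity_notMem (hF : IsDistortedDisk F) (hγ : IsClosedCurve γ)
    (hγd : range γ ⊆ domain) (h : infinity ∉ range γ) (hγF : Bounds γ F) : area F ≠ ⊤ := by
  have hc := isClosedCurve_coord hγ hγd h
  obtain ⟨R, hR⟩ := hc.isCompact_range.isBounded.subset_ball (0 : ℂ)
  have hcount : ∀ᵐ P ∂areaMeasure, Measure.count (layers F P) ≤ (layers F infinity).ncard +
      (invCoord '' ball 0 R).indicator
        (fun P => ‖windingNumber (fun θ => coord (γ θ)) (coord P)‖ₑ) P := by
    filter_upwards [measure_eq_zero_iff_ae_notMem.1 (areaMeasure_range hγ hγd)] with P hP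
    exact hF.count_layers_le hγ hγd h hγF hR hP
  rw [hF.area_eq_lintegral_count]
  refine ne_top_of_le_ne_top ?_ (lintegral_mono_ae hcount)
  rw [lintegral_add_left measurable_const, lintegral_const,
    lintegral_indicator (measurableSet_invCoord_image measurableSet_ball)]
  exact ENNReal.add_ne_top.2 ⟨ENNReal.mul_ne_top (ENNReal.natCast_ne_top _) (measure_ne_top _ _),
    lintegral_coord_ne_top hc.measurable_windingNumber.enorm
      (hc.integrableOn_windingNumber R).hasFiniteIntegral.ne⟩

lemma area_ne_top (hF : IsDistortedDisk F) (hγ : IsClosedCurve γ) (hγd : range γ ⊆ domain)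
    (hγF : Bounds γ F) : area F ≠ ⊤ := by
  obtain ⟨P, hP, hPγ⟩ : (domain \ range γ).Nonempty := by
    refine nonempty_of_measure_ne_zero (μ := areaMeasure) ?_
    rw [measure_sdiff_null (areaMeasure_range hγ hγd), areaMeasure_domain]
    exact areaMeasure_univ_ne_zero
  obtain ⟨R, hRP, hRdet⟩ := exists_rotation hP
  rw [← area_rotate F R]
  refine (hF.rotate R hRdet).area_ne_top_of_infinity_notMem (γ := fun θ => R (γ θ))
    (hγ.comp_contDiffOn (subset_univ _) R.contDiff.contDiffOn) ?_ ?_ ?_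
  · rintro _ ⟨θ, rfl⟩
    exact map_mem_domain R (hγd ⟨θ, rfl⟩)
  · rintro ⟨θ, hθ⟩
    exact hPγ ⟨θ, R.injective (hθ.trans hRP.symm)⟩
  · obtain ⟨φ, hφ, hφm, hφp, hFφ⟩ := hγF
    exact ⟨φ, hφ, hφm, hφp, fun θ => congrArg R (hFφ θ)⟩

end IsDistortedDisk

end Sphere

/-! ### The area of distorted disks in the sphere -/

namespace Sphere

variable {γ : ℝ → Space} {F : ℂ → Space}

section Components

variable {K Ω : Set Space}

lemma isOpen_preimage_component (hK : IsClosed K) (hΩ : Ω ∈ complementComponents domain K) :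
    IsOpen ((Subtype.val : sphere (0 : Space) 1 → Space) ⁻¹' Ω) := by
  have : LocallyConnectedSpace (sphere (0 : Space) 1) :=
    ChartedSpace.locallyConnectedSpace (EuclideanSpace ℝ (Fin 2)) _
  obtain ⟨P, -, rfl⟩ := hΩ
  have hU : IsOpen ((Subtype.val : sphere (0 : Space) 1 → Space) ⁻¹' Kᶜ) :=
    hK.isOpen_compl.preimage continuous_subtype_val
  have hUK : (Subtype.val : sphere (0 : Space) 1 → Space) '' (Subtype.val ⁻¹' Kᶜ) = domain \ K :=
    Subtype.image_preimage_coe _ _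
  refine isOpen_iff_mem_nhds.2 fun Q hQ => ?_
  have hQU : Q ∈ (Subtype.val : sphere (0 : Space) 1 → Space) ⁻¹' Kᶜ :=
    (connectedComponentIn_subset _ _ hQ).2
  refine Filter.mem_of_superset (hU.connectedComponentIn.mem_nhds
    (mem_connectedComponentIn hQU)) ?_
  rw [← image_subset_iff, connectedComponentIn_eq hQ, ← hUK]
  exact (isPreconnected_connectedComponentIn.image _
    continuous_subtype_val.continuousOn).subset_connectedComponentIn
      (mem_image_of_mem _ (mem_connectedComponentIn hQU))
      (image_mono (connectedComponentIn_subset _ _))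

lemma measurableSet_component (hK : IsClosed K) (hΩ : Ω ∈ complementComponents domain K) :
    MeasurableSet Ω := by
  have hm := (MeasurableEmbedding.subtype_coe isClosed_sphere.measurableSet).measurableSet_image'
    (isOpen_preimage_component hK hΩ).measurableSet
  have hΩd : Ω ⊆ sphere 0 1 := (subset_of_mem_complementComponents hΩ).trans sdiff_subset
  rwa [Subtype.image_preimage_coe, inter_eq_right.2 hΩd] at hm

lemma countable_components (hK : IsClosed K) : Countable (complementComponents domain K) := by
  refine Pairwise.countable_of_isOpen_disjoint
    (fun Ω₁ Ω₂ h => (pairwise_disjoint_complementComponents domain K h).preimage Subtype.val)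
    (fun Ω => isOpen_preimage_component hK Ω.2) fun Ω => ?_
  obtain ⟨P, hP⟩ := nonempty_of_mem_complementComponents Ω.2
  exact ⟨⟨P, (subset_of_mem_complementComponents Ω.2 hP).1⟩, hP⟩

end Components

lemma IsDistortedDisk.hasSum_area (hF : IsDistortedDisk F) (hγ : IsClosedCurve γ)
    (hγd : range γ ⊆ domain) (hγF : Bounds γ F) {ν : Set Space → ℤ}
    (hν : ∀ Ω ∈ complementComponents domain (range γ), ∀ P ∈ Ω,
      (layers F P).Finite ∧ ((layers F P).ncard : ℤ) = ν Ω) :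
    HasSum (fun Ω : {Ω : Set Space // Ω ∈ complementComponents domain (range γ)} =>
      (ν Ω.1 : ℝ) * (setArea Ω.1).toReal) (area F).toReal := by
  have hK := hγ.isCompact_range.isClosed
  have := countable_components hK
  have hempty : ∀ᵐ P ∂areaMeasure, P ∉ ⋃ Ω : complementComponents domain (range γ), Ω.1 →
      layers F P = ∅ := by
    filter_upwards [measure_eq_zero_iff_ae_notMem.1 (areaMeasure_range hγ hγd)] with P hP hPΩ
    exact hF.layers_eq_empty fun hPd => hPΩ (mem_iUnion.2
      ⟨⟨_, P, ⟨hPd, hP⟩, rfl⟩, mem_connectedComponentIn ⟨hPd, hP⟩⟩)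
  have hfin := hF.area_ne_top hγ hγd hγF
  rw [hF.area_eq_lintegral_count] at hfin ⊢
  convert hasSum_mul_measure_of_layers (fun Ω => measurableSet_component hK Ω.2)
    (pairwise_disjoint_complementComponents domain (range γ)) (fun Ω => hν Ω.1 Ω.2) hempty hfin
    using 3 with Ω
  rw [areaMeasure_apply]

lemma isCurveLift_coord (hγ : IsClosedCurve γ) (hγd : range γ ⊆ domain)
    (h : infinity ∉ range γ) : IsCurveLift γ fun θ => (1, coord (γ θ)) where
  continuous := continuous_const.prodMk (isClosedCurve_coord hγ hγd h).continuous
  periodic θ := by simp only [hγ.periodic θ]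
  isLift θ := isLift_coord (hγd ⟨θ, rfl⟩) fun h₀ => h ⟨θ, h₀⟩

lemma IsDistortedDisk.hasDegree_wedge_of_isSimpleLift (hF : IsDistortedDisk F) (hγF : Bounds γ F)
    {Γ : ℝ → ℂ × ℂ} (hΓ : IsCurveLift γ Γ) (hs : IsSimpleLift Γ) (hγd : range γ ⊆ domain)
    {P : Space} (hP : P ∈ domain \ range γ) {p : ℂ × ℂ} (hp : IsLift P p) :
    HasDegree (fun θ => wedge p (Γ θ)) (layers F P).ncard := by
  obtain ⟨Γ', hΓ', hs', hlayers⟩ := hF.exists_isCurveLift hγF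
  obtain ⟨n, hn⟩ := hΓ.exists_hasDegree_of_isPreconnected hγd isPreconnected_singleton
    (singleton_subset_iff.2 hP)
  have hdegree := hn P rfl p hp
  rwa [hΓ.eq_of_isSimpleLift hΓ' hs hs' hdegree (hlayers P hP.2 p hp).2] at hdegree

/-- If no distorted disk is bounded by `γ`, any lift of `γ` will do; otherwise all simple lifts
yield the same degrees. -/
lemma exists_hasDegree_wedge_ncard_layers {Γ₀ : ℝ → ℂ × ℂ} (hΓ₀ : IsCurveLift γ Γ₀)
    (hγd : range γ ⊆ domain) :
    ∃ Γ, IsCurveLift γ Γ ∧ ∀ F, IsDistortedDisk F → Bounds γ F → ∀ P ∈ domain \ range γ,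
      ∀ p, IsLift P p → HasDegree (fun θ => wedge p (Γ θ)) (layers F P).ncard := by
  by_cases hF : ∃ F, IsDistortedDisk F ∧ Bounds γ F
  · obtain ⟨F₀, hF₀, hγF₀⟩ := hF
    obtain ⟨Γ, hΓ, hs, -⟩ := hF₀.exists_isCurveLift hγF₀
    exact ⟨Γ, hΓ, fun F hF hγF P hP p hp =>
      hF.hasDegree_wedge_of_isSimpleLift hγF hΓ hs hγd hP hp⟩
  · exact ⟨Γ₀, hΓ₀, fun F hF₁ hγF => (hF ⟨F, hF₁, hγF⟩).elim⟩

/-- A curve without lift bounds no distorted disk and passes through `infinity`, so that any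
integers will do. -/
lemma exists_ncard_layers_eq (hγ : IsClosedCurve γ) (hγd : range γ ⊆ domain) :
    ∃ ν : Set Space → ℤ,
      (infinity ∉ range γ → ∀ Ω₀ ∈ complementComponents domain (range γ), infinity ∈ Ω₀ →
        ∀ Ω ∈ complementComponents domain (range γ), ∀ P ∈ Ω, P ≠ infinity →
          windingNumber (fun θ => coord (γ θ)) (coord P) = ν Ω - ν Ω₀) ∧
      ∀ F, IsDistortedDisk F → Bounds γ F → ∀ Ω ∈ complementComponents domain (range γ),
        ∀ P ∈ Ω, ((layers F P).ncard : ℤ) = ν Ω := by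
  by_cases hlift : ∃ Γ, IsCurveLift γ Γ
  swap
  · refine ⟨0, fun h => (hlift ⟨_, isCurveLift_coord hγ hγd h⟩).elim, fun F hF hγF => ?_⟩
    obtain ⟨Γ, hΓ, -⟩ := hF.exists_isCurveLift hγF
    exact (hlift ⟨Γ, hΓ⟩).elim
  obtain ⟨Γ₀, hΓ₀⟩ := hlift
  obtain ⟨Γ, hΓ, hlayers⟩ := exists_hasDegree_wedge_ncard_layers hΓ₀ hγd
  choose! ν hν using fun Ω (hΩ : Ω ∈ complementComponents domain (range γ)) =>
    hΓ.exists_hasDegree_of_isPreconnected hγd (isPreconnected_of_mem_complementComponents hΩ)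
      (subset_of_mem_complementComponents hΩ)
  refine ⟨ν, fun h Ω₀ hΩ₀ hi Ω hΩ P hP hPi => ?_, fun F hF hγF Ω hΩ P hP => ?_⟩
  · have hPd := (subset_of_mem_complementComponents hΩ hP).1
    rw [(isClosedCurve_coord hγ hγd h).windingNumber_eq (hΓ.hasDegree_coord_sub hγd h
      (hν Ω hΩ P hP _ (isLift_coord hPd hPi)) (hν Ω₀ hΩ₀ _ hi _ isLift_infinity)), Int.cast_sub]
  · have hPm := subset_of_mem_complementComponents hΩ hP
    obtain ⟨p, hp⟩ := exists_isLift hPm.1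
    exact (hlayers F hF hγF P hPm p hp).unique (hν Ω hΩ P hP p hp)

theorem area_eq_sum (hγ : IsClosedCurve γ) (hγd : range γ ⊆ domain) :
    ∃ ν : Set Space → ℤ,
      (infinity ∉ range γ → ∀ Ω₀ ∈ complementComponents domain (range γ), infinity ∈ Ω₀ →
        ∀ Ω ∈ complementComponents domain (range γ), ∀ P ∈ Ω, P ≠ infinity →
          windingNumber (fun θ => coord (γ θ)) (coord P) = ν Ω - ν Ω₀) ∧
      ∀ F : ℂ → Space, IsDistortedDisk F → Bounds γ F →
        (∀ Ω ∈ complementComponents domain (range γ), ∀ P ∈ Ω,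
          (layers F P).Finite ∧ ((layers F P).ncard : ℤ) = ν Ω) ∧
        area F ≠ ⊤ ∧
        HasSum (fun Ω : {Ω : Set Space // Ω ∈ complementComponents domain (range γ)} =>
          (ν Ω.1 : ℝ) * (setArea Ω.1).toReal) (area F).toReal := by
  obtain ⟨ν, hwinding, hncard⟩ := exists_ncard_layers_eq hγ hγd
  refine ⟨ν, hwinding, fun F hF hγF => ?_⟩
  have hlayers : ∀ Ω ∈ complementComponents domain (range γ), ∀ P ∈ Ω,
      (layers F P).Finite ∧ ((layers F P).ncard : ℤ) = ν Ω := fun Ω hΩ P hP =>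
    ⟨hF.finite_layers hγF (subset_of_mem_complementComponents hΩ hP), hncard F hF hγF Ω hΩ P hP⟩
  exact ⟨hlayers, hF.area_ne_top hγ hγd hγF, hF.hasSum_area hγ hγd hγF hlayers⟩

end Sphere

lemma eq_of_hasSum_toReal {ι : Type*} {f : ι → ℝ} {a b : ENNReal}
    (ha : a ≠ ⊤ ∧ HasSum f a.toReal) (hb : b ≠ ⊤ ∧ HasSum f b.toReal) : a = b :=
  (ENNReal.toReal_eq_toReal_iff' ha.1 hb.1).1 (ha.2.unique hb.2)

end DistortedDisk

theorem mainTheorem6 :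
    -- the Euclidean plane and the hyperbolic plane
    (∀ (G : DistortedDisk.PlaneGeometry) (γ : ℝ → ℂ),
      DistortedDisk.IsClosedCurve γ → range γ ⊆ G.domain →
      (∃ ν : Set ℂ → ℤ,
        (∀ Ω ∈ DistortedDisk.complementComponents univ (range γ), ∀ P ∈ Ω,
          DistortedDisk.windingNumber γ P = ν Ω) ∧
        ∀ F : ℂ → ℂ, G.IsDistortedDisk F → DistortedDisk.Bounds γ F →
          (∀ Ω ∈ DistortedDisk.complementComponents univ (range γ), ∀ P ∈ Ω,
            (DistortedDisk.layers F P).Finite ∧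
              ((DistortedDisk.layers F P).ncard : ℤ) = ν Ω) ∧
          G.area F ≠ ⊤ ∧
          HasSum (fun Ω : {Ω : Set ℂ //
              Ω ∈ DistortedDisk.complementComponents univ (range γ) ∧ Bornology.IsBounded Ω} =>
            (ν Ω.1 : ℝ) * (G.setArea Ω.1).toReal) (G.area F).toReal) ∧
      ∀ F₁ F₂ : ℂ → ℂ, G.IsDistortedDisk F₁ → G.IsDistortedDisk F₂ →
        DistortedDisk.Bounds γ F₁ → DistortedDisk.Bounds γ F₂ → G.area F₁ = G.area F₂) ∧
    -- the round sphere
    (∀ γ : ℝ → DistortedDisk.Space,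
      DistortedDisk.IsClosedCurve γ → range γ ⊆ DistortedDisk.Sphere.domain →
      (∃ ν : Set DistortedDisk.Space → ℤ,
        (DistortedDisk.Sphere.infinity ∉ range γ →
          ∀ Ω₀ ∈ DistortedDisk.complementComponents DistortedDisk.Sphere.domain (range γ),
          DistortedDisk.Sphere.infinity ∈ Ω₀ →
          ∀ Ω ∈ DistortedDisk.complementComponents DistortedDisk.Sphere.domain (range γ),
          ∀ P ∈ Ω, P ≠ DistortedDisk.Sphere.infinity →
            DistortedDisk.windingNumber (fun θ => DistortedDisk.Sphere.coord (γ θ))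
              (DistortedDisk.Sphere.coord P) = ν Ω - ν Ω₀) ∧
        ∀ F : ℂ → DistortedDisk.Space,
          DistortedDisk.Sphere.IsDistortedDisk F → DistortedDisk.Bounds γ F →
          (∀ Ω ∈ DistortedDisk.complementComponents DistortedDisk.Sphere.domain (range γ),
            ∀ P ∈ Ω, (DistortedDisk.layers F P).Finite ∧
              ((DistortedDisk.layers F P).ncard : ℤ) = ν Ω) ∧
          DistortedDisk.Sphere.area F ≠ ⊤ ∧
          HasSum (fun Ω : {Ω : Set DistortedDisk.Space //
              Ω ∈ DistortedDisk.complementComponents DistortedDisk.Sphere.domain (range γ)} =>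
            (ν Ω.1 : ℝ) * (DistortedDisk.Sphere.setArea Ω.1).toReal)
            (DistortedDisk.Sphere.area F).toReal) ∧
      ∀ F₁ F₂ : ℂ → DistortedDisk.Space,
        DistortedDisk.Sphere.IsDistortedDisk F₁ → DistortedDisk.Sphere.IsDistortedDisk F₂ →
        DistortedDisk.Bounds γ F₁ → DistortedDisk.Bounds γ F₂ →
        DistortedDisk.Sphere.area F₁ = DistortedDisk.Sphere.area F₂) := by
  refine ⟨fun G γ hγ _ => ?_, fun γ hγ hγd => ?_⟩
  · obtain ⟨ν, hν, hF⟩ := G.area_eq_sum hγ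
    exact ⟨⟨ν, hν, hF⟩, fun F₁ F₂ hF₁ hF₂ hγF₁ hγF₂ =>
      DistortedDisk.eq_of_hasSum_toReal (hF F₁ hF₁ hγF₁).2 (hF F₂ hF₂ hγF₂).2⟩
  · obtain ⟨ν, hν, hF⟩ := DistortedDisk.Sphere.area_eq_sum hγ hγd
    exact ⟨⟨ν, hν, hF⟩, fun F₁ F₂ hF₁ hF₂ hγF₁ hγF₂ =>
      DistortedDisk.eq_of_hasSum_toReal (hF F₁ hF₁ hγF₁).2 (hF F₂ hF₂ hγF₂).2⟩
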